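/- Let $d\in\{1,2\}$ and let $D\subset\mathbb{R}^d$ be a nonempty, convex, bounded, open set, which is a polygon if $d=2$. Let $(\mathcal{T}_h)_{h\in I}$, $I\subset(0,\infty)$, be a shape-regular and quasi-uniform family of meshes of $D$: each $\mathcal{T}_h$ is a finite set of nondegenerate compact intervals ($d=1$) or closed nondegenerate triangles ($d=2$) with pairwise disjoint interiors and union $\overline D$; $h=\max_{K\in\mathcal{T}_h}h_K$, where $h_K$ is the diameter of $K$; and there are constants $\upsilon,\sigma>0$ with $h_K\le\upsilon\rho_K$ and $h_K\ge\sigma h$ for all $K\in\mathcal{T}_h$, $h\in I$, where $\rho_K$ is the diameter of the largest ball in $K$. Let $U_h\subset L^2(D)$ be the space of functions that are a.e. constant on each $K\in\mathcal{T}_h$, and let $\Pi_h\colon L^2(D)\to U_h$ be the $L^2(D)$-orthogonal projection. Write $|v|_{H^1(\Omega)}=\|\nabla v\|_{L^2(\Omega)^d}$ and $[a,b]=\{u\in L^2(D): a\le u\le b \text{ a.e.}\}$. We call $c_\Pi>0$ admissible if, for all $h\in I$ and $K\in\mathcal{T}_h$, $$\|\Pi_hv-v\|_{L^2(\mathring K)}\le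 c_\Pi h_K|v|_{H^1(\mathring K)}\quad (v\in H^1(\mathring K)),\qquad \|\Pi_hv-v\|_{L^2(D)}\le c_\Pi h|v|_{H^1(D)}\quad (v\in H^1(D)).$$ (In the first estimate, $v$ is extended to a function in $L^2(D)$; the choice of the extension does not matter.) For a Hilbert space $H$ and $\phi\colon H\to(-\infty,\infty]$, $\mathrm{dom}(\phi)=\{u:\phi(u)<\infty\}$, and $\mathrm{prox}_\phi(u)$ denotes the unique minimizer over $v\in H$ of $\tfrac12\|v-u\|_H^2+\phi(v)$; for $C\subset H$, $I_C$ is the indicator function ($0$ on $C$, $\infty$ elsewhere) and $\mathrm{proj}_C=\mathrm{prox}_{I_C}$. Proximity operators of functions on $U_h$ and projections onto subsets of $U_h$ are taken in the Hilbert space $U_h$ with the $L^2(D)$-inner product. Let $\beta\ge0$, let $\mathfrak l,\mathfrak u\in H^1(D)\cap L^\infty(D)$ with $\mathfrak l\le\mathfrak u$ a.e., and put $\mathfrak l_h=\Pi_h\mathfrak l$, $\mathfrak u_h=\Pi_h\mathfrak u$. Define $\psi\colon L^2(D)\to[0,\infty]$ and $\psi_h\colon U_h\to[0,\infty]$ by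 $$\psi(u)=\beta\|u\|_{L^1(D)}+I_{[\mathfrak l,\mathfrak u]}(u),\qquad \psi_h(u_h)=\beta\|u_h\|_{L^1(D)}+I_{U_h\cap[\mathfrak l_h,\mathfrak u_h]}(u_h).$$ Then there is an absolute constant that is admissible (for all such $d$, $D$ and families of meshes), and the following hold. (a) For every admissible $c_\Pi>0$ and all $h\in I$, $\tau>0$, $v_h\in U_h$, the projections and proximal points below exist and are unique, and $$\|\mathrm{proj}_{[\mathfrak l,\mathfrak u]}(v_h)-\mathrm{proj}_{U_h\cap[\mathfrak l_h,\mathfrak u_h]}(v_h)\|_{L^2(D)}\le c_\Pi h\big(|\mathfrak l|_{H^1(D)}+|\mathfrak u|_{H^1(D)}\big),$$ $$\|\mathrm{prox}_{\psi/\tau}(v_h)-\mathrm{prox}_{\psi_h/\tau}(v_h)\|_{L^2(D)}\le c_\Pi h\big(|\mathfrak l|_{H^1(D)}+|\mathfrak u|_{H^1(D)}\big).$$ (b) $\psi$ is proper, convex and closed, and $\mathrm{dom}(\psi)=[\mathfrak l,\mathfrak u]$. (c) For all $h\in I$ and $v\in[\mathfrak l,\mathfrak u]$, $\Pi_hv\in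 U_h\cap[\mathfrak l_h,\mathfrak u_h]$. (d) For all $h\in I$, $\psi_h$ is proper, convex and closed, and $\mathrm{dom}(\psi_h)=U_h\cap[\mathfrak l_h,\mathfrak u_h]$. (e) If $\mathfrak l$ and $\mathfrak u$ are constant, then $\mathrm{dom}(\psi_h)\subset\mathrm{dom}(\psi)$ and $\psi_h=\psi$ on $U_h$ for all $h\in I$. (f) For all $u\in L^2(D)$ and $h\in I$, $\|\Pi_hu\|_{L^1(D)}\le\|u\|_{L^1(D)}$. -/

import Mathlib

open MeasureTheory Set Filter Topology
open scoped ENNReal ContDiff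

noncomputable section

/-! ### Extended-real valued convex functions on a Hilbert space -/

section ConvexAnalysis

variable {H : Type*} [NormedAddCommGroup H] [InnerProductSpace ℝ H]

/-- The (effective) domain of `φ`. -/
def effDom (φ : H → EReal) : Set H := {u | φ u < ⊤}

/-- `φ` takes values in `(-∞, ∞]` and is not identically `∞`. -/
def IsProper (φ : H → EReal) : Prop := (∀ u, φ u ≠ ⊥) ∧ ∃ u, φ u ≠ ⊤

/-- Convexity of an extended-real valued function: its epigraph is convex. -/
def IsConvexFun (φ : H → EReal) : Prop :=
  Convex ℝ {p : H × ℝ | φ p.1 ≤ (p.2 : EReal)}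

/-- Closedness of an extended-real valued function: its epigraph is closed. -/
def IsClosedFun (φ : H → EReal) : Prop :=
  IsClosed {p : H × ℝ | φ p.1 ≤ (p.2 : EReal)}

open Classical in
/-- The indicator function of a set: `0` on the set and `∞` off it. -/
def indicatorFun (C : Set H) (u : H) : EReal := if u ∈ C then 0 else ⊤

/-- `p = prox_φ(u)`: the point `p` is the one and only minimizer over `v ∈ H` of
`(1/2) ‖v - u‖² + φ v`. -/
def IsProx (φ : H → EReal) (u p : H) : Prop :=
  {q : H | IsMinOn (fun v : H => (((1 / 2 : ℝ) * ‖v - u‖ ^ 2 : ℝ) : EReal) + φ v) univ q} = {p}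

/-- `p = proj_C(u)`, where `proj_C` is the proximity operator of the indicator function of `C`. -/
def IsProj (C : Set H) (u p : H) : Prop := IsProx (indicatorFun C) u p

/-- The function `φ/τ`. -/
def scaleFun (φ : H → EReal) (τ : ℝ) (u : H) : EReal := ((τ⁻¹ : ℝ) : EReal) * φ u

end ConvexAnalysis

/-! ### Lebesgue and Sobolev spaces -/

/-- The Euclidean space `ℝ^d`. -/
abbrev Eucl (d : ℕ) := EuclideanSpace ℝ (Fin d)

/-- The Hilbert space `L²(D)`.  Its order is the almost everywhere order, so that
`Set.Icc a b` is the `L²(D)`-box `[a, b]`. -/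
abbrev L2 {d : ℕ} (D : Set (Eucl d)) := Lp ℝ 2 (volume.restrict D)

/-- `G` is a weak gradient of `f` on the open set `Ω` (tested with `C_c^∞(Ω)`). -/
def IsWeakGradient {d : ℕ} (Ω : Set (Eucl d)) (f : Eucl d → ℝ) (G : Eucl d → Eucl d) : Prop :=
  ∀ φ : Eucl d → ℝ, ContDiff ℝ ∞ φ → HasCompactSupport φ → tsupport φ ⊆ Ω → ∀ i : Fin d,
    ∫ x in Ω, f x * fderiv ℝ φ x (EuclideanSpace.single i 1) = - ∫ x in Ω, G x i * φ x

/-- `f` (restricted to the open set `Ω`) belongs to `H¹(Ω)`. -/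
def MemH1 {d : ℕ} (Ω : Set (Eucl d)) (f : Eucl d → ℝ) : Prop :=
  MemLp f 2 (volume.restrict Ω) ∧
    ∃ G : Lp (Eucl d) 2 (volume.restrict Ω), IsWeakGradient Ω f G

/-- The seminorm `|f|_{H¹(Ω)} = ‖∇f‖_{L²(Ω)^d}`.  For `f ∈ H¹(Ω)` the weak gradient is unique,
so that the infimum is over a set with exactly one element. -/
def h1Seminorm {d : ℕ} (Ω : Set (Eucl d)) (f : Eucl d → ℝ) : ℝ :=
  sInf {r : ℝ | ∃ G : Lp (Eucl d) 2 (volume.restrict Ω), IsWeakGradient Ω f G ∧ r = ‖G‖}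

/-! ### Domains and meshes -/

/-- A convex bounded domain in `ℝ^d`, which for `d = 2` is a polygon (its boundary is a finite
union of line segments). -/
structure IsConvexDomain {d : ℕ} (D : Set (Eucl d)) : Prop where
  isOpen : IsOpen D
  nonempty : D.Nonempty
  convex : Convex ℝ D
  bounded : Bornology.IsBounded D
  polygon : d = 2 → ∃ S : Finset (Eucl d × Eucl d), frontier D = ⋃ p ∈ S, segment ℝ p.1 p.2

/-- A nondegenerate closed simplex: a compact interval if `d = 1`, a closed triangle if `d = 2`. -/
def IsClosedSimplex {d : ℕ} (K : Set (Eucl d)) : Prop :=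
  ∃ p : Fin (d + 1) → Eucl d, AffineIndependent ℝ p ∧ K = convexHull ℝ (range p)

/-- A mesh of `D`: finitely many closed simplices which cover the closure of `D` and have
pairwise disjoint interiors. -/
structure IsMesh {d : ℕ} (D : Set (Eucl d)) (T : Finset (Set (Eucl d))) : Prop where
  simplex : ∀ K ∈ T, IsClosedSimplex K
  cover : ⋃ K ∈ T, K = closure D
  disjoint : ∀ K ∈ T, ∀ L ∈ T, K ≠ L → Disjoint (interior K) (interior L)

/-- The diameter of the largest Euclidean ball contained in `K`. -/
def inDiam {d : ℕ} (K : Set (Eucl d)) : ℝ :=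
  sSup {δ : ℝ | ∃ (x : Eucl d) (r : ℝ), 0 ≤ r ∧ Metric.closedBall x r ⊆ K ∧ δ = 2 * r}

/-- A shape-regular and quasi-uniform family `(T_h)` of meshes of `D`, where `h` runs through a set
`I` of positive numbers, and `h` is the maximal diameter of the elements of `T_h`. -/
structure IsMeshFamily {d : ℕ} (D : Set (Eucl d)) (I : Set ℝ)
    (T : ℝ → Finset (Set (Eucl d))) : Prop where
  pos : ∀ h ∈ I, 0 < h
  mesh : ∀ h ∈ I, IsMesh D (T h)
  meshSize : ∀ h ∈ I, IsGreatest {r : ℝ | ∃ K ∈ T h, r = Metric.diam K} h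
  shapeRegular : ∃ υ : ℝ, 0 < υ ∧ ∀ h ∈ I, ∀ K ∈ T h, Metric.diam K ≤ υ * inDiam K
  quasiUniform : ∃ σ : ℝ, 0 < σ ∧ ∀ h ∈ I, ∀ K ∈ T h, σ * h ≤ Metric.diam K

/-! ### Piecewise constant functions -/

/-- The space `U_h` of functions which are (almost everywhere) constant on each element of a mesh.
As a mesh is finite and covers `D`, such functions are in `L^∞(D)`. -/
def pcSpace {d : ℕ} (D : Set (Eucl d)) (T : Finset (Set (Eucl d))) : Submodule ℝ (L2 D) where
  carrier := {u | ∀ K ∈ T, ∃ c : ℝ, ∀ᵐ x ∂(volume.restrict D), x ∈ K → u x = c}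
  zero_mem' := fun K _ => ⟨0, by
    filter_upwards [Lp.coeFn_zero ℝ 2 (volume.restrict D)] with x hx _
    simpa using hx⟩
  add_mem' := by
    intro u v hu hv K hK
    obtain ⟨a, ha⟩ := hu K hK
    obtain ⟨b, hb⟩ := hv K hK
    refine ⟨a + b, ?_⟩
    filter_upwards [Lp.coeFn_add u v, ha, hb] with x hx h1 h2 hxK
    exact hx.trans (congrArg₂ (· + ·) (h1 hxK) (h2 hxK))
  smul_mem' := by
    intro r u hu K hK
    obtain ⟨a, ha⟩ := hu K hK
    refine ⟨r * a, ?_⟩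
    filter_upwards [Lp.coeFn_smul r u, ha] with x hx h1 hxK
    exact hx.trans (congrArg (r * ·) (h1 hxK))

/-- The space of piecewise constant functions is closed, so that the orthogonal projection
onto it exists. -/
theorem isClosed_pcSpace {d : ℕ} (D : Set (Eucl d)) (T : Finset (Set (Eucl d))) :
    IsClosed (pcSpace D T : Set (L2 D)) := by
  refine IsSeqClosed.isClosed ?_
  intro w u hw hu K hK
  obtain ⟨ns, -, hns⟩ := (tendstoInMeasure_of_tendsto_Lp hu).exists_seq_tendsto_ae
  choose c hc using fun n => hw n K hK
  have hc' : ∀ᵐ x ∂(volume.restrict D), ∀ n, x ∈ K → w n x = c n := ae_all_iff.2 hc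
  by_cases hex : ∃ x ∈ K, (∀ n, w n x = c n) ∧ Tendsto (fun i => w (ns i) x) atTop (𝓝 (u x))
  · obtain ⟨x, -, h1, h2⟩ := hex
    refine ⟨u x, ?_⟩
    filter_upwards [hns, hc'] with y hy1 hy2 hyK
    refine tendsto_nhds_unique hy1 ?_
    simpa only [hy2 _ hyK, h1] using h2
  · refine ⟨0, ?_⟩
    filter_upwards [hns, hc'] with y hy1 hy2 hyK
    exact absurd ⟨y, hyK, fun n => hy2 n hyK, hy1⟩ hex

instance instCompletePcSpace {d : ℕ} (D : Set (Eucl d)) (T : Finset (Set (Eucl d))) :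
    CompleteSpace (pcSpace D T) :=
  (isClosed_pcSpace D T).completeSpace_coe

/-- The `L²(D)`-orthogonal projection `Π_h` onto the space of piecewise constant functions. -/
def projPC {d : ℕ} (D : Set (Eucl d)) (T : Finset (Set (Eucl d))) : L2 D →L[ℝ] pcSpace D T :=
  (pcSpace D T).orthogonalProjectionOnto

/-- `c` is an admissible constant in the approximation estimates for the family of projections
`Π_h`, both locally on each element and globally on `D`.  (A function in `H¹` of the interior of an
element is represented by an extension of it to a function in `L²(D)`; the values of `Π_h v` on
an element only depend on the values of `v` there.) -/
def IsProjectionConstant {d : ℕ} (D : Set (Eucl d)) (I : Set ℝ)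
    (T : ℝ → Finset (Set (Eucl d))) (c : ℝ) : Prop :=
  (∀ h ∈ I, ∀ K ∈ T h, ∀ v : L2 D, MemH1 (interior K) v →
    eLpNorm (fun x => (projPC D (T h) v : L2 D) x - v x) 2 (volume.restrict (interior K)) ≤
      ENNReal.ofReal (c * Metric.diam K * h1Seminorm (interior K) v)) ∧
  (∀ h ∈ I, ∀ v : L2 D, MemH1 D v →
    ‖(projPC D (T h) v : L2 D) - v‖ ≤ c * h * h1Seminorm D v)

/-! ### The regularizer with box constraints and its discretization -/

/-- `‖u‖_{L¹(D)}`. -/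
def l1Norm {d : ℕ} (D : Set (Eucl d)) (u : L2 D) : ℝ≥0∞ := eLpNorm u 1 (volume.restrict D)

/-- `ψ(u) = β ‖u‖_{L¹(D)} + I_{[l,u]}(u)` on `L²(D)`. -/
def psi {d : ℕ} (D : Set (Eucl d)) (β : ℝ) (lo up : L2 D) (u : L2 D) : EReal :=
  ((ENNReal.ofReal β * l1Norm D u : ℝ≥0∞) : EReal) + indicatorFun (Icc lo up) u

/-- The discrete box `U_h ∩ [l_h, u_h]`, as a subset of `U_h`. -/
def discreteBox {d : ℕ} (D : Set (Eucl d)) (T : Finset (Set (Eucl d)))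
    (lo up : pcSpace D T) : Set (pcSpace D T) :=
  {u | (u : L2 D) ∈ Icc (lo : L2 D) (up : L2 D)}

/-- `ψ_h(u) = β ‖u‖_{L¹(D)} + I_{U_h ∩ [l_h,u_h]}(u)` on `U_h`. -/
def psiH {d : ℕ} (D : Set (Eucl d)) (T : Finset (Set (Eucl d))) (β : ℝ)
    (lo up : pcSpace D T) (u : pcSpace D T) : EReal :=
  ((ENNReal.ofReal β * l1Norm D (u : L2 D) : ℝ≥0∞) : EReal) +
    indicatorFun (discreteBox D T lo up) u

end

/-! Two independent facts carry the theorem.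

The constant 2 is admissible because of a Poincaré inequality on convex sets whose constant depends
only on `d` and the diameter. For smooth `f`, `f x - f y` is an integral of the gradient along a
segment. After squaring and integrating over all pairs, at each parameter `t` one substitutes in the
endpoint whose weight is at least 1/2, which costs at most `2 ^ d`
(`lintegral_lintegral_enorm_sub_sq_le`). Mollification on inner parallel sets and Fatou's lemma pass
to weak gradients. On an element the projection is the mean value, hence the best constant;
averaging over competitors `v y` gives the local estimate, and summing squares over elements gives
the global one.

The bounds in (a) hold because both minimization problems are solved pointwise by one formula,
`clampSoft`: soft thresholding followed by clamping to the bounds. The piecewise constants form a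
vector sublattice containing the constants, so the formula with discrete bounds does not leave that
space. A scalar variational inequality (`clamp_softThreshold_variational`), once integrated,
certifies the unique minimizer in either space. Only the clamping bounds differ, and clamping is
Lipschitz in them, so the distance is at most the sum of the projection errors of the two bounds.

The remaining properties come from the explicit epigraphs and from the projection preserving order,
integrals and constants. -/

/-! ### The Poincaré inequality on convex sets for smooth functions -/

/-- A form of the Cauchy-Schwarz inequality. -/
theorem sq_lintegral_le_measure_univ_mul {α : Type*} [MeasurableSpace α] (μ : Measure α)
    {g : α → ℝ≥0∞} (hg : AEMeasurable g μ) :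
    (∫⁻ a, g a ∂μ) ^ 2 ≤ μ univ * ∫⁻ a, g a ^ 2 ∂μ := by
  have h := ENNReal.lintegral_mul_le_Lp_mul_Lq μ Real.HolderConjugate.two_two
    (aemeasurable_const (b := (1 : ℝ≥0∞))) hg
  simp only [Pi.mul_apply, one_mul, ENNReal.rpow_two, one_pow, lintegral_one] at h
  calc (∫⁻ a, g a ∂μ) ^ 2
      ≤ (μ univ ^ (1 / 2 : ℝ) * (∫⁻ a, g a ^ 2 ∂μ) ^ (1 / 2 : ℝ)) ^ 2 := by gcongr
    _ = μ univ * ∫⁻ a, g a ^ 2 ∂μ := by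
        rw [mul_pow, ← ENNReal.rpow_two, ← ENNReal.rpow_two, ← ENNReal.rpow_mul,
          ← ENNReal.rpow_mul]
        norm_num

/-- The substitution has Jacobian `t ^ d`, whose inverse is at most `2 ^ d`; this is the only source
of the dimensional factor. -/
theorem lintegral_comp_add_smul_le {d : ℕ} {F : Eucl d → ℝ≥0∞} (hF : Measurable F)
    (c : Eucl d) {t : ℝ} (ht : 1 / 2 ≤ t) :
    ∫⁻ x, F (c + t • x) ≤ 2 ^ d * ∫⁻ x, F x := by
  have ht0 : 0 < t := by linarith
  have h1 : ∫⁻ x, F (c + t • x) = ∫⁻ z, F (c + z) ∂(Measure.map (fun x => t • x) volume) :=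
    (lintegral_map (hF.comp (measurable_const_add c)) (measurable_const_smul t)).symm
  rw [h1, Measure.map_addHaar_smul _ ht0.ne', lintegral_smul_measure,
    lintegral_add_left_eq_self F c, smul_eq_mul]
  gcongr
  rw [finrank_euclideanSpace_fin, abs_of_pos (by positivity)]
  have : (2 : ℝ≥0∞) ^ d = ENNReal.ofReal (2 ^ d) := by
    rw [ENNReal.ofReal_pow (by norm_num)]; norm_num
  rw [this, ← inv_pow]
  gcongr
  rw [inv_le_comm₀ ht0 (by norm_num)]
  linarith

/-- The increment of a smooth function is controlled by its gradient along the segment. -/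
theorem enorm_sub_sq_le_lintegral_segment {d : ℕ} {f : Eucl d → ℝ} (hf : ContDiff ℝ 1 f)
    (x y : Eucl d) {R : ℝ} (hR : dist x y ≤ R) :
    ‖f x - f y‖ₑ ^ 2 ≤
      ENNReal.ofReal R ^ 2 * ∫⁻ t in Ioc (0 : ℝ) 1, ‖fderiv ℝ f (y + t • (x - y))‖ₑ ^ 2 := by
  have hc : Continuous fun t : ℝ => fderiv ℝ f (y + t • (x - y)) :=
    (hf.continuous_fderiv one_ne_zero).comp (by fun_prop)
  have hd : ∀ t : ℝ, HasDerivAt (fun t : ℝ => f (y + t • (x - y)))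
      (fderiv ℝ f (y + t • (x - y)) (x - y)) t := by
    intro t
    have h1 : HasDerivAt (fun t : ℝ => y + t • (x - y)) (x - y) t := by
      simpa using ((hasDerivAt_id t).smul_const (x - y)).const_add y
    exact ((hf.differentiable one_ne_zero) _).hasFDerivAt.comp_hasDerivAt t h1
  have hftc := intervalIntegral.integral_eq_sub_of_hasDerivAt (a := 0) (b := 1)
    (fun t _ => hd t) ((hc.clm_apply continuous_const).intervalIntegrable 0 1)
  rw [intervalIntegral.integral_of_le zero_le_one] at hftc
  have hfxy : f x - f y = ∫ t in Ioc (0 : ℝ) 1, fderiv ℝ f (y + t • (x - y)) (x - y) := by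
    rw [hftc]; simp
  have hle : ‖f x - f y‖ₑ ≤
      ENNReal.ofReal R * ∫⁻ t in Ioc (0 : ℝ) 1, ‖fderiv ℝ f (y + t • (x - y))‖ₑ := by
    rw [hfxy, ← lintegral_const_mul' _ _ ENNReal.ofReal_ne_top]
    refine (enorm_integral_le_lintegral_enorm _).trans (lintegral_mono fun t => ?_)
    refine (ContinuousLinearMap.le_opENorm _ _).trans ?_
    rw [mul_comm]
    gcongr
    rw [← ofReal_norm, ← dist_eq_norm]
    exact ENNReal.ofReal_le_ofReal hR
  calc ‖f x - f y‖ₑ ^ 2 ≤ _ := pow_le_pow_left' hle 2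
    _ ≤ _ := by
      rw [mul_pow]
      gcongr
      refine (sq_lintegral_le_measure_univ_mul _ hc.measurable.enorm.aemeasurable).trans ?_
      simp

/-- Integrate the segment estimate over all pairs and exchange integrals. In `(1 - t) • y + t • x`
one of the two weights is at least 1/2: freeze the other endpoint and substitute in this one.
Splitting at `t = 1 / 2` avoids the singular Jacobian at the ends of the segment. -/
theorem lintegral_lintegral_enorm_sub_sq_le {d : ℕ} {f : Eucl d → ℝ} (hf : ContDiff ℝ 1 f)
    {A : Set (Eucl d)} (hA : MeasurableSet A) (hconv : Convex ℝ A) {R : ℝ}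
    (hR : ∀ x ∈ A, ∀ y ∈ A, dist x y ≤ R) :
    ∫⁻ x in A, ∫⁻ y in A, ‖f x - f y‖ₑ ^ 2 ≤
      ENNReal.ofReal R ^ 2 * (2 ^ d * volume A * ∫⁻ x in A, ‖fderiv ℝ f x‖ₑ ^ 2) := by
  -- Extension by zero allows substitution on the whole space; convexity of `A` keeps the segments
  -- where `F` is the squared gradient.
  set F : Eucl d → ℝ≥0∞ := A.indicator fun x => ‖fderiv ℝ f x‖ₑ ^ 2 with hFdef
  have hF : Measurable F :=
    ((hf.continuous_fderiv one_ne_zero).measurable.enorm.pow_const 2).indicator hA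
  have hFint : ∫⁻ x, F x = ∫⁻ x in A, ‖fderiv ℝ f x‖ₑ ^ 2 := lintegral_indicator hA _
  have hpt : ∀ x ∈ A, ∀ y ∈ A, ‖f x - f y‖ₑ ^ 2 ≤
      ENNReal.ofReal R ^ 2 * ∫⁻ t in Ioc (0 : ℝ) 1, F (y + t • (x - y)) := by
    intro x hx y hy
    refine (enorm_sub_sq_le_lintegral_segment hf x y (hR x hx y hy)).trans ?_
    refine mul_le_mul' le_rfl (setLIntegral_mono' measurableSet_Ioc fun t ht => ?_)
    rw [hFdef, indicator_of_mem (hconv.add_smul_sub_mem hy hx ⟨ht.1.le, ht.2⟩)]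
  have hslice : ∀ t ∈ Ioc (0 : ℝ) 1, ∫⁻ x in A, ∫⁻ y in A, F (y + t • (x - y)) ≤
      2 ^ d * volume A * ∫⁻ x, F x := by
    intro t ht
    have key : ∀ s : ℝ, 1 / 2 ≤ s → ∀ c : Eucl d → Eucl d,
        ∫⁻ y in A, ∫⁻ x in A, F (c y + s • x) ≤ 2 ^ d * volume A * ∫⁻ x, F x := by
      intro s hs c
      calc ∫⁻ y in A, ∫⁻ x in A, F (c y + s • x)
          ≤ ∫⁻ _ in A, 2 ^ d * ∫⁻ x, F x := lintegral_mono fun y =>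
            (setLIntegral_le_lintegral _ _).trans (lintegral_comp_add_smul_le hF (c y) hs)
        _ = 2 ^ d * volume A * ∫⁻ x, F x := by
            rw [setLIntegral_const]; ring
    rcases le_total (1 / 2) t with h | h
    · have hm : Measurable fun p : Eucl d × Eucl d => F (p.2 + t • (p.1 - p.2)) :=
        hF.comp (by fun_prop)
      rw [lintegral_lintegral_swap hm.aemeasurable]
      refine le_of_eq_of_le ?_ (key t h fun y => (1 - t) • y)
      refine lintegral_congr fun y => lintegral_congr fun x => congrArg F ?_
      module
    · refine le_of_eq_of_le ?_ (key (1 - t) (by linarith) fun x => t • x)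
      refine lintegral_congr fun y => lintegral_congr fun x => congrArg F ?_
      module
  calc ∫⁻ x in A, ∫⁻ y in A, ‖f x - f y‖ₑ ^ 2
      ≤ ∫⁻ x in A, ∫⁻ y in A,
          ENNReal.ofReal R ^ 2 * ∫⁻ t in Ioc (0 : ℝ) 1, F (y + t • (x - y)) :=
        setLIntegral_mono' hA fun x hx => setLIntegral_mono' hA fun y hy => hpt x hx y hy
    _ = ENNReal.ofReal R ^ 2 *
          ∫⁻ x in A, ∫⁻ y in A, ∫⁻ t in Ioc (0 : ℝ) 1, F (y + t • (x - y)) := by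
        have hne : ENNReal.ofReal R ^ 2 ≠ ⊤ := ENNReal.pow_ne_top ENNReal.ofReal_ne_top
        rw [← lintegral_const_mul' _ _ hne]
        simp_rw [lintegral_const_mul' _ _ hne]
    _ = ENNReal.ofReal R ^ 2 *
          ∫⁻ t in Ioc (0 : ℝ) 1, ∫⁻ x in A, ∫⁻ y in A, F (y + t • (x - y)) := by
        have hm : Measurable fun q : (Eucl d × ℝ) × Eucl d => F (q.2 + q.1.2 • (q.1.1 - q.2)) :=
          hF.comp (by fun_prop)
        rw [← lintegral_lintegral_swap (f := fun x t => ∫⁻ y in A, F (y + t • (x - y)))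
          (hm.lintegral_prod_right' (ν := volume.restrict A)).aemeasurable]
        congr 1
        refine lintegral_congr fun x => lintegral_lintegral_swap ?_
        have hm' : Measurable fun q : Eucl d × ℝ => F (q.1 + q.2 • (x - q.1)) :=
          hF.comp (by fun_prop)
        exact hm'.aemeasurable
    _ ≤ ENNReal.ofReal R ^ 2 * ∫⁻ _ in Ioc (0 : ℝ) 1, 2 ^ d * volume A * ∫⁻ x, F x := by
        exact mul_le_mul' le_rfl (setLIntegral_mono' measurableSet_Ioc hslice)
    _ = _ := by
        rw [setLIntegral_const, hFint]; simp

/-! ### Mollification of weakly differentiable functions -/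

/-- The mollification of the extension of `v|_Ω` by zero. -/
noncomputable def mollify {d : ℕ} (Ω : Set (Eucl d)) (φ : ContDiffBump (0 : Eucl d))
    (v : Eucl d → ℝ) : Eucl d → ℝ :=
  convolution (Ω.indicator v) (φ.normed volume) (ContinuousLinearMap.lsmul ℝ ℝ).flip volume

theorem contDiff_mollify {d : ℕ} {Ω : Set (Eucl d)} (φ : ContDiffBump (0 : Eucl d))
    {v : Eucl d → ℝ} (hv : Integrable (Ω.indicator v)) : ContDiff ℝ 1 (mollify Ω φ v) :=
  φ.hasCompactSupport_normed.contDiff_convolution_right (n := 1) _ hv.locallyIntegrable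
    φ.contDiff_normed

/-- The derivative is put on the kernel, which is the form the weak gradient is tested with. -/
theorem fderiv_mollify_apply {d : ℕ} {Ω : Set (Eucl d)} (hΩ : MeasurableSet Ω)
    (φ : ContDiffBump (0 : Eucl d)) {v : Eucl d → ℝ} (hv : Integrable (Ω.indicator v))
    (x w : Eucl d) :
    fderiv ℝ (mollify Ω φ v) x w = ∫ t in Ω, v t * fderiv ℝ (φ.normed volume) (x - t) w := by
  have h := (φ.hasCompactSupport_normed (μ := volume)).hasFDerivAt_convolution_right
    (ContinuousLinearMap.lsmul ℝ ℝ).flip hv.locallyIntegrable (φ.contDiff_normed (n := 1)) x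
  have hex := (((φ.hasCompactSupport_normed (μ := volume)).fderiv ℝ).convolutionExists_right
    ((ContinuousLinearMap.lsmul ℝ ℝ).flip.precompR (Eucl d)) hv.locallyIntegrable
    ((φ.contDiff_normed (n := 1)).continuous_fderiv one_ne_zero)) x
  rw [mollify, h.fderiv, convolution_def, ContinuousLinearMap.integral_apply hex,
    ← integral_indicator hΩ]
  refine integral_congr_ae (ae_of_all _ fun t => ?_)
  by_cases ht : t ∈ Ω <;>
    simp [ht, ContinuousLinearMap.precompR_apply, mul_comm]

/-- If the kernel centred at `x` is supported in `Ω`, it is an admissible test function, so the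
gradient of the mollification is the mollified weak gradient. Jensen's inequality then moves the
square inside. -/
theorem enorm_fderiv_mollify_sq_le {d : ℕ} {Ω : Set (Eucl d)} (hΩ : MeasurableSet Ω)
    (φ : ContDiffBump (0 : Eucl d)) {v : Eucl d → ℝ} (hv : Integrable (Ω.indicator v))
    {G : Eucl d → Eucl d} (hGm : Measurable G) (hG : IntegrableOn G Ω)
    (hw : IsWeakGradient Ω v G) {x : Eucl d} (hx : Metric.closedBall x φ.rOut ⊆ Ω) :
    ‖fderiv ℝ (mollify Ω φ v) x‖ₑ ^ 2 ≤
      ∫⁻ t in Ω, ‖φ.normed volume (x - t)‖ₑ * ‖G t‖ₑ ^ 2 := by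
  set ψ : Eucl d → ℝ := fun t => φ.normed volume (x - t) with hψ
  have hψc : ContDiff ℝ ∞ ψ := (φ.contDiff_normed (n := ⊤)).comp (contDiff_const.sub contDiff_id)
  have hψsupp : tsupport ψ ⊆ Metric.closedBall x φ.rOut := by
    refine closure_minimal (fun t ht => ?_) Metric.isClosed_closedBall
    have : x - t ∈ Function.support (φ.normed volume) := ht
    rw [φ.support_normed_eq, mem_ball_zero_iff] at this
    rw [Metric.mem_closedBall', dist_eq_norm]
    exact this.le
  have hψcs : HasCompactSupport ψ :=
    HasCompactSupport.of_support_subset_isCompact (isCompact_closedBall x φ.rOut)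
      ((subset_tsupport ψ).trans hψsupp)
  have hψG : Integrable (fun t => ψ t • G t) (volume.restrict Ω) := by
    obtain ⟨C, hC⟩ := hψcs.exists_bound_of_continuous hψc.continuous
    exact hG.bdd_smul C hψc.continuous.aestronglyMeasurable (ae_of_all _ hC)
  set g : Eucl d := ∫ t in Ω, ψ t • G t with hg
  have hgi : ∀ i, fderiv ℝ (mollify Ω φ v) x (EuclideanSpace.single i 1) = g i := by
    intro i
    have h1 : g i = ∫ t in Ω, G t i * ψ t := by
      have := (EuclideanSpace.proj (𝕜 := ℝ) i : Eucl d →L[ℝ] ℝ).integral_comp_comm hψG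
      refine this.symm.trans (integral_congr_ae (ae_of_all _ fun t => ?_))
      simp [mul_comm]
    have h2 := hw ψ hψc hψcs (hψsupp.trans hx) i
    rw [h1, fderiv_mollify_apply hΩ φ hv, ← neg_eq_iff_eq_neg.mpr h2, ← integral_neg]
    refine integral_congr_ae (ae_of_all _ fun t => ?_)
    -- The reflection in `ψ` contributes a minus sign, which cancels the one from integration by
    -- parts.
    have h3 : HasFDerivAt ψ
        ((fderiv ℝ (φ.normed volume) (x - t)).comp (-ContinuousLinearMap.id ℝ (Eucl d))) t :=
      (((φ.contDiff_normed (n := 1)).differentiable one_ne_zero) (x - t)).hasFDerivAt.comp t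
        ((hasFDerivAt_id t).const_sub x)
    simp [h3.fderiv]
  have hnorm : ‖fderiv ℝ (mollify Ω φ v) x‖ ≤ ‖g‖ := by
    have : fderiv ℝ (mollify Ω φ v) x = innerSL ℝ g := by
      refine ContinuousLinearMap.coe_injective
        ((EuclideanSpace.basisFun (Fin d) ℝ).toBasis.ext fun i => ?_)
      simpa [EuclideanSpace.inner_single_right] using hgi i
    rw [this, innerSL_apply_norm]
  have hψm : Measurable fun t => ‖ψ t‖ₑ := hψc.continuous.measurable.enorm
  -- The kernel has total mass 1, so `ν` has mass at most 1 and Cauchy-Schwarz acts as Jensen's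
  -- inequality.
  set ν := (volume.restrict Ω).withDensity fun t => ‖ψ t‖ₑ with hν
  have hνuniv : ν univ ≤ 1 := by
    rw [hν, withDensity_apply _ MeasurableSet.univ, Measure.restrict_univ]
    refine (setLIntegral_le_lintegral _ _).trans ?_
    rw [lintegral_sub_left_eq_self (fun t => ‖φ.normed volume t‖ₑ) x]
    have h1 := ofReal_integral_eq_lintegral_ofReal (φ.integrable_normed (μ := volume))
      (ae_of_all _ φ.nonneg_normed)
    rw [φ.integral_normed] at h1
    refine le_of_eq ?_
    rw [← ENNReal.ofReal_one, h1]
    exact lintegral_congr fun t => Real.enorm_of_nonneg (φ.nonneg_normed t)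
  have hgle : ‖g‖ₑ ≤ ∫⁻ t, ‖G t‖ₑ ∂ν := by
    rw [hν, lintegral_withDensity_eq_lintegral_mul _ hψm hGm.enorm]
    refine (enorm_integral_le_lintegral_enorm _).trans (le_of_eq ?_)
    exact lintegral_congr fun t => by simp [enorm_smul]
  calc ‖fderiv ℝ (mollify Ω φ v) x‖ₑ ^ 2 ≤ (∫⁻ t, ‖G t‖ₑ ∂ν) ^ 2 := by
        refine pow_le_pow_left' (le_trans ?_ hgle) 2
        rw [← ofReal_norm, ← ofReal_norm]
        exact ENNReal.ofReal_le_ofReal hnorm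
    _ ≤ ν univ * ∫⁻ t, ‖G t‖ₑ ^ 2 ∂ν :=
        sq_lintegral_le_measure_univ_mul ν hGm.enorm.aemeasurable
    _ ≤ 1 * ∫⁻ t, ‖G t‖ₑ ^ 2 ∂ν := by gcongr
    _ = _ := by
        rw [one_mul, hν, lintegral_withDensity_eq_lintegral_mul _ hψm (hGm.enorm.pow_const 2)]
        rfl

/-- By Tonelli, integrating the pointwise bound in `x` first leaves the kernel's mass 1, so
mollification does not increase the gradient norm. -/
theorem lintegral_enorm_fderiv_mollify_sq_le {d : ℕ} {Ω : Set (Eucl d)} (hΩ : MeasurableSet Ω)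
    (φ : ContDiffBump (0 : Eucl d)) {v : Eucl d → ℝ} (hv : Integrable (Ω.indicator v))
    {G : Eucl d → Eucl d} (hGm : Measurable G) (hG : IntegrableOn G Ω)
    (hw : IsWeakGradient Ω v G) {A : Set (Eucl d)} (hA : MeasurableSet A)
    (hAΩ : ∀ x ∈ A, Metric.closedBall x φ.rOut ⊆ Ω) :
    ∫⁻ x in A, ‖fderiv ℝ (mollify Ω φ v) x‖ₑ ^ 2 ≤ ∫⁻ t in Ω, ‖G t‖ₑ ^ 2 := by
  have hφm : Measurable fun t => ‖φ.normed volume t‖ₑ := φ.continuous_normed.measurable.enorm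
  calc ∫⁻ x in A, ‖fderiv ℝ (mollify Ω φ v) x‖ₑ ^ 2
      ≤ ∫⁻ x in A, ∫⁻ t in Ω, ‖φ.normed volume (x - t)‖ₑ * ‖G t‖ₑ ^ 2 :=
        setLIntegral_mono' hA fun x hx =>
          enorm_fderiv_mollify_sq_le hΩ φ hv hGm hG hw (hAΩ x hx)
    _ ≤ ∫⁻ x, ∫⁻ t in Ω, ‖φ.normed volume (x - t)‖ₑ * ‖G t‖ₑ ^ 2 :=
        setLIntegral_le_lintegral _ _
    _ = ∫⁻ t in Ω, ∫⁻ x, ‖φ.normed volume (x - t)‖ₑ * ‖G t‖ₑ ^ 2 := by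
        have hm : Measurable fun p : Eucl d × Eucl d =>
            ‖φ.normed volume (p.1 - p.2)‖ₑ * ‖G p.2‖ₑ ^ 2 :=
          (hφm.comp (measurable_fst.sub measurable_snd)).mul
            ((hGm.comp measurable_snd).enorm.pow_const 2)
        exact lintegral_lintegral_swap hm.aemeasurable
    _ = ∫⁻ t in Ω, ‖G t‖ₑ ^ 2 := by
        refine lintegral_congr fun t => ?_
        have h1 := ofReal_integral_eq_lintegral_ofReal (φ.integrable_normed (μ := volume))
          (ae_of_all _ φ.nonneg_normed)
        rw [φ.integral_normed, ENNReal.ofReal_one] at h1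
        rw [lintegral_mul_const' _ _ (ENNReal.pow_ne_top enorm_ne_top),
          lintegral_sub_right_eq_self (fun x => ‖φ.normed volume x‖ₑ) t]
        simp_rw [Real.enorm_of_nonneg (φ.nonneg_normed _)]
        rw [← h1, one_mul]

/-! ### The Poincaré inequality on convex sets -/

/-- The points whose closed `ρ`-ball lies in the closure of `Ω`. -/
def innerParallel {d : ℕ} (Ω : Set (Eucl d)) (ρ : ℝ) : Set (Eucl d) :=
  {x | ∀ w : Eucl d, ‖w‖ ≤ ρ → x + w ∈ closure Ω}

theorem isClosed_innerParallel {d : ℕ} (Ω : Set (Eucl d)) (ρ : ℝ) :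
    IsClosed (innerParallel Ω ρ) := by
  have : innerParallel Ω ρ =
      ⋂ (w : Eucl d) (_ : ‖w‖ ≤ ρ), (fun x => x + w) ⁻¹' closure Ω := by
    ext x; simp [innerParallel]
  rw [this]
  exact isClosed_biInter fun w _ => isClosed_closure.preimage (by fun_prop)

theorem convex_innerParallel {d : ℕ} {Ω : Set (Eucl d)} (hΩ : Convex ℝ Ω) (ρ : ℝ) :
    Convex ℝ (innerParallel Ω ρ) := by
  intro x hx y hy a b ha hb hab w hw
  have h := hΩ.closure (hx w hw) (hy w hw) ha hb hab
  have e : a • (x + w) + b • (y + w) = a • x + b • y + w := by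
    rw [smul_add, smul_add, add_add_add_comm, ← add_smul, hab, one_smul]
  rwa [e] at h

/-- A nonempty open convex set is the interior of its closure; the strict inequality leaves room for
an open ball around the closed one. -/
theorem closedBall_subset_of_mem_innerParallel {d : ℕ} {Ω : Set (Eucl d)} (hΩ : Convex ℝ Ω)
    (hO : IsOpen Ω) (hne : Ω.Nonempty) {ρ r : ℝ} (hr : r < ρ) {x : Eucl d}
    (hx : x ∈ innerParallel Ω ρ) : Metric.closedBall x r ⊆ Ω := by
  have hint : interior (closure Ω) = Ω := by
    rw [hΩ.interior_closure_eq_interior_of_nonempty_interior (by rwa [hO.interior_eq]),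
      hO.interior_eq]
  rw [← hint]
  refine (Metric.closedBall_subset_ball hr).trans
    (interior_maximal (fun y hy => ?_) Metric.isOpen_ball)
  have := hx (y - x) (by rw [← dist_eq_norm]; exact (Metric.mem_ball.1 hy).le)
  simpa using this

theorem mem_innerParallel_of_ball_subset {d : ℕ} {Ω : Set (Eucl d)} {ρ r : ℝ} (hr : ρ < r)
    {x : Eucl d} (hx : Metric.ball x r ⊆ Ω) : x ∈ innerParallel Ω ρ := fun w hw =>
  subset_closure (hx (by simpa using hw.trans_lt hr))

/-- The Poincaré inequality on a convex set, in a form that avoids mean values. -/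
theorem lintegral_enorm_sub_sq_le_of_isWeakGradient {d : ℕ} {Ω : Set (Eucl d)} (hO : IsOpen Ω)
    (hconv : Convex ℝ Ω) (hb : Bornology.IsBounded Ω) {R : ℝ}
    (hR : ∀ x ∈ Ω, ∀ y ∈ Ω, dist x y ≤ R) {v : Eucl d → ℝ} (hv : IntegrableOn v Ω)
    {G : Eucl d → Eucl d} (hGm : Measurable G) (hG : IntegrableOn G Ω)
    (hw : IsWeakGradient Ω v G) :
    ∫⁻ x in Ω, ∫⁻ y in Ω, ‖v x - v y‖ₑ ^ 2 ≤
      ENNReal.ofReal R ^ 2 * (2 ^ d * volume Ω * ∫⁻ x in Ω, ‖G x‖ₑ ^ 2) := by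
  rcases Ω.eq_empty_or_nonempty with rfl | hne
  · simp
  have hΩ := hO.measurableSet
  have hv0 : Integrable (Ω.indicator v) := (integrable_indicator_iff hΩ).2 hv
  set ε : ℕ → ℝ := fun n => 1 / ((n : ℝ) + 1) with hε
  have hε0 : ∀ n, 0 < ε n := fun n => Nat.one_div_pos_of_nat
  have hεlim : Tendsto ε atTop (𝓝 0) := tendsto_one_div_add_atTop_nhds_zero_nat
  -- The outer radius is twice the inner one, the bounded ratio needed for almost everywhere
  -- convergence. The sets `A n` use `3 * ε n` to exceed the outer radius strictly.
  let φ : ℕ → ContDiffBump (0 : Eucl d) := fun n =>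
    ⟨ε n, 2 * ε n, hε0 n, by linarith [hε0 n]⟩
  set f : ℕ → Eucl d → ℝ := fun n => mollify Ω (φ n) v with hf
  set A : ℕ → Set (Eucl d) := fun n => innerParallel Ω (3 * ε n) with hAdef
  have hA : ∀ n, MeasurableSet (A n) := fun n => (isClosed_innerParallel Ω _).measurableSet
  have hball : ∀ n, ∀ x ∈ A n, Metric.closedBall x (φ n).rOut ⊆ Ω := fun n x hx =>
    closedBall_subset_of_mem_innerParallel hconv hO hne
      (by change 2 * ε n < 3 * ε n; linarith [hε0 n]) hx
  have hAΩ : ∀ n, A n ⊆ Ω := fun n x hx =>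
    hball n x hx (Metric.mem_closedBall_self (φ n).rOut_pos.le)
  have hlim : ∀ᵐ x ∂(volume.restrict Ω), Tendsto (fun n => f n x) atTop (𝓝 (v x)) := by
    have h := ContDiffBump.ae_convolution_tendsto_right_of_locallyIntegrable (φ := φ)
      (l := atTop) (K := 2) (by simpa using hεlim.const_mul 2)
      (Eventually.of_forall fun n => le_rfl) hv0.locallyIntegrable
    filter_upwards [ae_restrict_of_ae h, ae_restrict_mem hΩ] with x hx hxΩ
    rw [indicator_of_mem hxΩ] at hx
    refine hx.congr fun n => ?_
    rw [hf]
    simp only [mollify, convolution_flip]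
  set μ := volume.restrict Ω with hμ
  -- Cutting off to `A n` keeps to the region where the mollified gradient is controlled. Every
  -- point of `Ω` is eventually in `A n`, so the cutoff disappears in the limit and Fatou's lemma
  -- applies.
  let Φ : ℕ → Eucl d × Eucl d → ℝ≥0∞ := fun n =>
    (A n ×ˢ A n).indicator fun p => ‖f n p.1 - f n p.2‖ₑ ^ 2
  have hfc : ∀ n, Continuous (f n) := fun n => (contDiff_mollify (φ n) hv0).continuous
  have hΦm0 : ∀ n, Measurable fun p : Eucl d × Eucl d => ‖f n p.1 - f n p.2‖ₑ ^ 2 := fun n =>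
    (((hfc n).comp continuous_fst).sub ((hfc n).comp continuous_snd)).measurable.enorm.pow_const 2
  have hΦm : ∀ n, Measurable (Φ n) := fun n => (hΦm0 n).indicator ((hA n).prod (hA n))
  have hΦle : ∀ n, ∫⁻ p, Φ n p ∂(μ.prod μ) ≤
      ENNReal.ofReal R ^ 2 * (2 ^ d * volume Ω * ∫⁻ x in Ω, ‖G x‖ₑ ^ 2) := by
    intro n
    calc ∫⁻ p, Φ n p ∂(μ.prod μ)
        = ∫⁻ x in A n, ∫⁻ y in A n, ‖f n x - f n y‖ₑ ^ 2 := by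
          rw [lintegral_indicator ((hA n).prod (hA n)), ← Measure.prod_restrict,
            Measure.restrict_restrict_of_subset (hAΩ n), lintegral_prod _ (hΦm0 n).aemeasurable]
      _ ≤ ENNReal.ofReal R ^ 2 *
            (2 ^ d * volume (A n) * ∫⁻ x in A n, ‖fderiv ℝ (f n) x‖ₑ ^ 2) :=
          lintegral_lintegral_enorm_sub_sq_le (contDiff_mollify (φ n) hv0) (hA n)
            (convex_innerParallel hconv _) fun x hx y hy => hR x (hAΩ n hx) y (hAΩ n hy)
      _ ≤ _ := by
          have h1 : volume (A n) ≤ volume Ω := measure_mono (hAΩ n)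
          have h2 := lintegral_enorm_fderiv_mollify_sq_le hΩ (φ n) hv0 hGm hG hw (hA n) (hball n)
          exact mul_le_mul' le_rfl (mul_le_mul' (mul_le_mul' le_rfl h1) h2)
  have hev : ∀ x ∈ Ω, ∀ᶠ n in atTop, x ∈ A n := by
    intro x hx
    obtain ⟨r, hr, hrΩ⟩ := Metric.isOpen_iff.1 hO x hx
    have : Tendsto (fun n => 3 * ε n) atTop (𝓝 0) := by simpa using hεlim.const_mul 3
    filter_upwards [this.eventually_lt_const hr] with n hn
    exact mem_innerParallel_of_ball_subset hn hrΩ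
  have hgood : ∀ᵐ x ∂μ, (∀ᶠ n in atTop, x ∈ A n) ∧ Tendsto (fun n => f n x) atTop (𝓝 (v x)) := by
    filter_upwards [hlim, ae_restrict_mem hΩ] with x hx hxΩ using ⟨hev x hxΩ, hx⟩
  have hΦlim : ∀ᵐ x ∂μ, ∀ᵐ y ∂μ,
      liminf (fun n => Φ n (x, y)) atTop = ‖v x - v y‖ₑ ^ 2 := by
    filter_upwards [hgood] with x hx
    filter_upwards [hgood] with y hy
    refine Tendsto.liminf_eq ?_
    have h1 : Tendsto (fun n => ‖f n x - f n y‖ₑ ^ 2) atTop (𝓝 (‖v x - v y‖ₑ ^ 2)) :=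
      ((ENNReal.continuous_pow 2).tendsto _).comp ((hx.2.sub hy.2).enorm)
    refine h1.congr' ?_
    filter_upwards [hx.1, hy.1] with n hnx hny
    exact (indicator_of_mem (mk_mem_prod hnx hny)
      fun p : Eucl d × Eucl d => ‖f n p.1 - f n p.2‖ₑ ^ 2).symm
  calc ∫⁻ x, ∫⁻ y, ‖v x - v y‖ₑ ^ 2 ∂μ ∂μ
      = ∫⁻ x, ∫⁻ y, liminf (fun n => Φ n (x, y)) atTop ∂μ ∂μ := by
        refine lintegral_congr_ae ?_
        filter_upwards [hΦlim] with x hx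
        refine lintegral_congr_ae ?_
        filter_upwards [hx] with y hy using hy.symm
    _ = ∫⁻ p, liminf (fun n => Φ n p) atTop ∂(μ.prod μ) :=
        (lintegral_prod _ (Measurable.liminf hΦm).aemeasurable).symm
    _ ≤ liminf (fun n => ∫⁻ p, Φ n p ∂(μ.prod μ)) atTop := lintegral_liminf_le hΦm
    _ ≤ _ := liminf_le_of_le (by isBoundedDefault) fun b hb => by
        obtain ⟨n, hn⟩ := hb.exists
        exact hn.trans (hΦle n)

/-! ### Meshes and the projection onto piecewise constant functions -/

theorem IsClosedSimplex.isCompact {d : ℕ} {K : Set (Eucl d)} (hK : IsClosedSimplex K) :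
    IsCompact K := by
  obtain ⟨p, -, rfl⟩ := hK
  exact (finite_range p).isCompact_convexHull ℝ

theorem IsClosedSimplex.convex {d : ℕ} {K : Set (Eucl d)} (hK : IsClosedSimplex K) :
    Convex ℝ K := by
  obtain ⟨p, -, rfl⟩ := hK
  exact convex_convexHull ℝ _

theorem IsConvexDomain.volume_lt_top {d : ℕ} {D : Set (Eucl d)} (hD : IsConvexDomain D) :
    volume D < ⊤ := hD.bounded.measure_lt_top

theorem IsConvexDomain.isFiniteMeasure {d : ℕ} {D : Set (Eucl d)} (hD : IsConvexDomain D) :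
    IsFiniteMeasure (volume.restrict D) := ⟨by simpa using hD.volume_lt_top⟩

section Mesh

variable {d : ℕ} {D : Set (Eucl d)} {T : Finset (Set (Eucl d))}

theorem IsMesh.interior_subset_domain (hT : IsMesh D T) (hD : IsConvexDomain D) {K : Set (Eucl d)}
    (hK : K ∈ T) : interior K ⊆ D := by
  have h1 : K ⊆ closure D := hT.cover ▸ subset_biUnion_of_mem (u := fun K => K) hK
  refine (interior_mono h1).trans (le_of_eq ?_)
  rw [hD.convex.interior_closure_eq_interior_of_nonempty_interior
    (by rw [hD.isOpen.interior_eq]; exact hD.nonempty), hD.isOpen.interior_eq]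

theorem IsMesh.measurableSet (hT : IsMesh D T) {K : Set (Eucl d)} (hK : K ∈ T) :
    MeasurableSet K := (hT.simplex K hK).isCompact.measurableSet

/-- Frontiers of convex sets are null, so elements and their interiors are interchangeable under
integrals. -/
theorem IsMesh.interior_ae_eq (hT : IsMesh D T) {K : Set (Eucl d)} (hK : K ∈ T) :
    interior K =ᵐ[volume] K :=
  interior_ae_eq_of_null_frontier ((hT.simplex K hK).convex.addHaar_frontier volume)

theorem IsMesh.restrict_restrict (hT : IsMesh D T) (hD : IsConvexDomain D) {K : Set (Eucl d)}
    (hK : K ∈ T) : (volume.restrict D).restrict K = volume.restrict (interior K) := by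
  rw [Measure.restrict_restrict (hT.measurableSet hK)]
  refine Measure.restrict_congr_set ?_
  have h : (interior K ∩ D : Set _) =ᵐ[volume] (K ∩ D : Set _) :=
    (hT.interior_ae_eq hK).inter (ae_eq_refl D)
  rw [inter_eq_left.2 (hT.interior_subset_domain hD hK)] at h
  exact h.symm

theorem IsMesh.measure_inter_eq_zero (hT : IsMesh D T) {K L : Set (Eucl d)}
    (hK : K ∈ T) (hL : L ∈ T) (h : K ≠ L) : volume (K ∩ L) = 0 := by
  have h1 : (interior K ∩ interior L : Set _) =ᵐ[volume] (K ∩ L : Set _) :=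
    (hT.interior_ae_eq hK).inter (hT.interior_ae_eq hL)
  rw [← measure_congr h1, (hT.disjoint K hK L hL h).inter_eq, measure_empty]

theorem IsMesh.indicatorConstLp_mem_pcSpace (hT : IsMesh D T) {K : Set (Eucl d)} (hK : K ∈ T)
    (hμ : volume.restrict D K ≠ ⊤) :
    indicatorConstLp 2 (hT.measurableSet hK) hμ (1 : ℝ) ∈ pcSpace D T := by
  intro L hL
  have h := indicatorConstLp_coeFn (p := 2) (hs := hT.measurableSet hK) (hμs := hμ) (c := (1 : ℝ))
  by_cases hKL : K = L
  · subst hKL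
    refine ⟨1, ?_⟩
    filter_upwards [h] with x hx hxK
    rw [hx, indicator_of_mem hxK]
  · refine ⟨0, ?_⟩
    have h0 : ∀ᵐ x ∂(volume.restrict D), x ∉ K ∩ L :=
      ae_restrict_of_ae (measure_eq_zero_iff_ae_notMem.1 (hT.measure_inter_eq_zero hK hL hKL))
    filter_upwards [h, h0] with x hx hx0 hxL
    rw [hx, indicator_of_notMem fun hxK => hx0 ⟨hxK, hxL⟩]

theorem inner_projPC_eq {w : L2 D} (hw : w ∈ pcSpace D T) (v : L2 D) :
    inner ℝ w (projPC D T v : L2 D) = inner ℝ w v := by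
  have h := Submodule.starProjection_inner_eq_zero (K := pcSpace D T) v w hw
  rw [inner_sub_left, sub_eq_zero, real_inner_comm, real_inner_comm w] at h
  exact h.symm

theorem projPC_eq_self {w : L2 D} (hw : w ∈ pcSpace D T) : (projPC D T w : L2 D) = w :=
  Submodule.starProjection_eq_self_iff.2 hw

theorem IsMesh.setIntegral_projPC (hT : IsMesh D T) (hD : IsConvexDomain D) {K : Set (Eucl d)}
    (hK : K ∈ T) (v : L2 D) :
    ∫ x in interior K, (projPC D T v : L2 D) x = ∫ x in interior K, v x := by
  have := hD.isFiniteMeasure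
  have h := inner_projPC_eq (hT.indicatorConstLp_mem_pcSpace hK (measure_ne_top _ _)) v
  rwa [L2.inner_indicatorConstLp_one, L2.inner_indicatorConstLp_one,
    hT.restrict_restrict hD hK] at h

theorem IsMesh.exists_projPC_ae_eq_const (hT : IsMesh D T) (hD : IsConvexDomain D)
    {K : Set (Eucl d)} (hK : K ∈ T) (v : L2 D) :
    ∃ a : ℝ, ∀ᵐ x ∂(volume.restrict (interior K)), (projPC D T v : L2 D) x = a := by
  obtain ⟨a, ha⟩ := (projPC D T v).2 K hK
  refine ⟨a, ?_⟩
  rw [← hT.restrict_restrict hD hK]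
  exact (ae_restrict_iff' (hT.measurableSet hK)).2 ha

/-- The mean value is the best approximation by constants. -/
theorem lintegral_enorm_sub_sq_le_of_integral_eq {α : Type*} [MeasurableSpace α] {μ : Measure α}
    [IsFiniteMeasure μ] {v : α → ℝ} (hv : MemLp v 2 μ) {a : ℝ} (ha : ∫ _, a ∂μ = ∫ x, v x ∂μ)
    (c : ℝ) : ∫⁻ x, ‖a - v x‖ₑ ^ 2 ∂μ ≤ ∫⁻ x, ‖v x - c‖ₑ ^ 2 ∂μ := by
  have hi : Integrable v μ := hv.integrable one_le_two
  have hva : Integrable (fun x => (a - v x) ^ 2) μ := ((memLp_const a).sub hv).integrable_sq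
  have hvc : Integrable (fun x => (v x - c) ^ 2) μ := (hv.sub (memLp_const c)).integrable_sq
  have hl : Integrable (fun x => 2 * (a - c) * (a - v x)) μ :=
    ((integrable_const a).sub hi).const_mul _
  have key : ∫ x, (a - v x) ^ 2 ∂μ ≤ ∫ x, (v x - c) ^ 2 ∂μ := by
    have h0 : ∫ x, 2 * (a - c) * (a - v x) ∂μ = 0 := by
      rw [integral_const_mul, integral_sub (integrable_const a) hi, ha, sub_self, mul_zero]
    -- Subtracting a term of zero integral turns the integrand into `(v x - c) ^ 2 - (a - c) ^ 2`.
    calc ∫ x, (a - v x) ^ 2 ∂μ = ∫ x, ((a - v x) ^ 2 - 2 * (a - c) * (a - v x)) ∂μ := by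
          rw [integral_sub hva hl, h0, sub_zero]
      _ ≤ ∫ x, (v x - c) ^ 2 ∂μ := integral_mono (hva.sub hl) hvc fun x => by
          dsimp only; nlinarith [sq_nonneg (a - c)]
  have e : ∀ r : ℝ, ‖r‖ₑ ^ 2 = ENNReal.ofReal (r ^ 2) := fun r => by
    rw [← sq_abs, ENNReal.ofReal_pow (abs_nonneg r), Real.enorm_eq_ofReal_abs]
  simp_rw [e]
  rw [← ofReal_integral_eq_lintegral_ofReal hva (ae_of_all _ fun x => sq_nonneg _),
    ← ofReal_integral_eq_lintegral_ofReal hvc (ae_of_all _ fun x => sq_nonneg _)]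
  exact ENNReal.ofReal_le_ofReal key

/-- Test functions supported in the smaller set are also test functions on the larger one, and the
integrands vanish in between. -/
theorem IsWeakGradient.mono {Ω Ω' : Set (Eucl d)} {v : Eucl d → ℝ} {G : Eucl d → Eucl d}
    (h : IsWeakGradient Ω v G) (hΩ : MeasurableSet Ω) (hsub : Ω' ⊆ Ω) :
    IsWeakGradient Ω' v G := by
  intro φ h1 h2 h3 i
  have h4 := h φ h1 h2 (h3.trans hsub) i
  rwa [setIntegral_eq_of_subset_of_forall_sdiff_eq_zero hΩ hsub,
    setIntegral_eq_of_subset_of_forall_sdiff_eq_zero hΩ hsub] at h4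
  · intro x hx
    rw [image_eq_zero_of_notMem_tsupport fun hxt => hx.2 (h3 hxt), mul_zero]
  · intro x hx
    rw [fderiv_of_notMem_tsupport ℝ fun hxt => hx.2 (h3 hxt)]
    simp

theorem eLpNorm_two_sq {α F : Type*} [MeasurableSpace α] [NormedAddCommGroup F] (μ : Measure α)
    (f : α → F) : eLpNorm f 2 μ ^ 2 = ∫⁻ x, ‖f x‖ₑ ^ 2 ∂μ := by
  have h := eLpNorm_nnreal_pow_eq_lintegral (f := f) (μ := μ) (p := 2) two_ne_zero
  simpa using h

/-- The local approximation estimate. -/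
theorem IsMesh.lintegral_enorm_projPC_sub_sq_le (hT : IsMesh D T) (hD : IsConvexDomain D)
    (hd : d ≤ 2) {K : Set (Eucl d)} (hK : K ∈ T) (v : L2 D) {G : Eucl d → Eucl d}
    (hGm : Measurable G) (hG : MemLp G 2 (volume.restrict (interior K)))
    (hw : IsWeakGradient (interior K) v G) :
    ∫⁻ x in interior K, ‖(projPC D T v : L2 D) x - v x‖ₑ ^ 2 ≤
      ENNReal.ofReal (2 * Metric.diam K) ^ 2 * ∫⁻ x in interior K, ‖G x‖ₑ ^ 2 := by
  set Ω := interior K with hΩ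
  have hKs := hT.simplex K hK
  have hfin : volume Ω ≠ ⊤ :=
    ((measure_mono interior_subset).trans_lt hKs.isCompact.measure_lt_top).ne
  have : IsFiniteMeasure (volume.restrict Ω) := ⟨by simpa using hfin.lt_top⟩
  rcases eq_or_ne (volume Ω) 0 with h0 | h0
  · rw [Measure.restrict_eq_zero.2 h0]; simp
  have hv : MemLp v 2 (volume.restrict Ω) :=
    (Lp.memLp v).mono_measure (Measure.restrict_mono (hT.interior_subset_domain hD hK) le_rfl)
  obtain ⟨a, ha⟩ := hT.exists_projPC_ae_eq_const hD hK v
  have hint : ∫ _ in Ω, a = ∫ x in Ω, v x := by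
    rw [← hT.setIntegral_projPC hD hK v]
    exact integral_congr_ae (ha.mono fun x hx => hx.symm)
  have hpoinc := lintegral_enorm_sub_sq_le_of_isWeakGradient isOpen_interior hKs.convex.interior
    (hKs.isCompact.isBounded.subset interior_subset) (R := Metric.diam K)
    (fun x hx y hy => Metric.dist_le_diam_of_mem hKs.isCompact.isBounded (interior_subset hx)
      (interior_subset hy)) (hv.integrable one_le_two) hGm (hG.integrable one_le_two) hw
  have hEq : ∫⁻ x in Ω, ‖(projPC D T v : L2 D) x - v x‖ₑ ^ 2 = ∫⁻ x in Ω, ‖a - v x‖ₑ ^ 2 :=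
    lintegral_congr_ae (ha.mono fun x hx => by simp only [hx])
  rw [hEq]
  -- Integrate over `y` the optimality of the mean against the constant `v y`; the positive finite
  -- factor `volume Ω` cancels afterwards. The 2 in the constant is the root of `2 ^ d ≤ 2 ^ 2`.
  have hmul : volume Ω * ∫⁻ x in Ω, ‖a - v x‖ₑ ^ 2 ≤
      volume Ω * (ENNReal.ofReal (2 * Metric.diam K) ^ 2 * ∫⁻ x in Ω, ‖G x‖ₑ ^ 2) := by
    calc volume Ω * ∫⁻ x in Ω, ‖a - v x‖ₑ ^ 2
        = ∫⁻ _ in Ω, ∫⁻ x in Ω, ‖a - v x‖ₑ ^ 2 := by rw [setLIntegral_const, mul_comm]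
      _ ≤ ∫⁻ y in Ω, ∫⁻ x in Ω, ‖v y - v x‖ₑ ^ 2 := lintegral_mono fun y => by
          refine (lintegral_enorm_sub_sq_le_of_integral_eq hv hint (v y)).trans (le_of_eq ?_)
          exact lintegral_congr fun x => by rw [← enorm_neg, neg_sub]
      _ ≤ _ := hpoinc
      _ ≤ ENNReal.ofReal (Metric.diam K) ^ 2 *
            (2 ^ 2 * volume Ω * ∫⁻ x in Ω, ‖G x‖ₑ ^ 2) := by
          gcongr
          exact one_le_two
      _ = _ := by
          rw [ENNReal.ofReal_mul zero_le_two, ENNReal.ofReal_ofNat]; ring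
  exact (ENNReal.mul_le_mul_iff_right h0 hfin).1 hmul

/-- The seminorm is an infimum over weak gradients, so a bound valid for each of them suffices and
their uniqueness is not needed. -/
theorem le_mul_h1Seminorm {Ω : Set (Eucl d)} {v : Eucl d → ℝ} (hv : MemH1 Ω v) {s b : ℝ}
    (hb : 0 ≤ b) (h : ∀ G : Lp (Eucl d) 2 (volume.restrict Ω), IsWeakGradient Ω v G →
      s ≤ b * ‖G‖) : s ≤ b * h1Seminorm Ω v := by
  obtain ⟨-, G, hG⟩ := hv
  rcases hb.eq_or_lt with rfl | hb
  · simpa using h G hG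
  rw [mul_comm, ← div_le_iff₀ hb]
  refine le_csInf ⟨_, G, hG, rfl⟩ ?_
  rintro _ ⟨G', hG', rfl⟩
  rw [div_le_iff₀ hb, mul_comm]
  exact h G' hG'

theorem IsMesh.eLpNorm_projPC_sub_le (hT : IsMesh D T) (hD : IsConvexDomain D)
    (hd : d ≤ 2) {K : Set (Eucl d)} (hK : K ∈ T) {v : L2 D} (hv : MemH1 (interior K) v) :
    eLpNorm (fun x => (projPC D T v : L2 D) x - v x) 2 (volume.restrict (interior K)) ≤
      ENNReal.ofReal (2 * Metric.diam K * h1Seminorm (interior K) v) := by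
  have hG : ∀ G : Lp (Eucl d) 2 (volume.restrict (interior K)), IsWeakGradient (interior K) v G →
      eLpNorm (fun x => (projPC D T v : L2 D) x - v x) 2 (volume.restrict (interior K)) ≤
        ENNReal.ofReal (2 * Metric.diam K * ‖G‖) := by
    intro G hG
    have h := hT.lintegral_enorm_projPC_sub_sq_le hD hd hK v (Lp.stronglyMeasurable G).measurable
      (Lp.memLp G) hG
    rw [← eLpNorm_two_sq, ← eLpNorm_two_sq, ← mul_pow] at h
    rw [ENNReal.ofReal_mul (by positivity), ofReal_norm, Lp.enorm_def]
    exact (ENNReal.pow_le_pow_left_iff two_ne_zero).1 h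
  obtain ⟨G₀, hG₀⟩ := hv.2
  rw [ENNReal.le_ofReal_iff_toReal_le ((hG G₀ hG₀).trans_lt ENNReal.ofReal_lt_top).ne]
  · refine le_mul_h1Seminorm hv (by positivity) fun G hG' => ?_
    exact ENNReal.toReal_le_of_le_ofReal (by positivity) (hG G hG')
  · refine mul_nonneg (by positivity) (Real.sInf_nonneg ?_)
    rintro _ ⟨G, -, rfl⟩
    exact norm_nonneg G

/-- A weak gradient on `D` restricts to each element; the squared local estimates add up because the
interiors are disjoint and lie in `D`. -/
theorem IsMesh.norm_projPC_sub_le (hT : IsMesh D T) (hD : IsConvexDomain D) (hd : d ≤ 2) {h : ℝ}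
    (hh : ∀ K ∈ T, Metric.diam K ≤ h) (h0 : 0 ≤ h) {v : L2 D} (hv : MemH1 D v) :
    ‖(projPC D T v : L2 D) - v‖ ≤ 2 * h * h1Seminorm D v := by
  refine le_mul_h1Seminorm hv (by positivity) fun G hG => ?_
  have hGm : Measurable G := (Lp.stronglyMeasurable G).measurable
  have hsq : ∫⁻ x in D, ‖(projPC D T v : L2 D) x - v x‖ₑ ^ 2 ≤
      ENNReal.ofReal (2 * h) ^ 2 * ∫⁻ x in D, ‖G x‖ₑ ^ 2 := by
    calc ∫⁻ x in D, ‖(projPC D T v : L2 D) x - v x‖ₑ ^ 2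
        ≤ ∫⁻ x in ⋃ K ∈ T, K, ‖(projPC D T v : L2 D) x - v x‖ₑ ^ 2 :=
          lintegral_mono_set (hT.cover ▸ subset_closure)
      _ ≤ ∑ K ∈ T, ∫⁻ x in K, ‖(projPC D T v : L2 D) x - v x‖ₑ ^ 2 := by
          have e : ⋃ K ∈ T, K = ⋃ K : T, (K : Set (Eucl d)) := by ext x; simp
          rw [e]
          refine (lintegral_iUnion_le _ _).trans_eq ?_
          rw [tsum_fintype]
          exact Finset.sum_coe_sort T
            fun K => ∫⁻ x in K, ‖(projPC D T v : L2 D) x - v x‖ₑ ^ 2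
      _ ≤ ∑ K ∈ T, ENNReal.ofReal (2 * h) ^ 2 * ∫⁻ x in interior K, ‖G x‖ₑ ^ 2 := by
          refine Finset.sum_le_sum fun K hK => ?_
          have hsub := hT.interior_subset_domain hD hK
          rw [← Measure.restrict_congr_set (hT.interior_ae_eq hK)]
          refine (hT.lintegral_enorm_projPC_sub_sq_le hD hd hK v hGm
            ((Lp.memLp G).mono_measure (Measure.restrict_mono hsub le_rfl))
            (hG.mono hD.isOpen.measurableSet hsub)).trans ?_
          gcongr
          exact hh K hK
      _ = ENNReal.ofReal (2 * h) ^ 2 * ∫⁻ x in ⋃ K ∈ T, interior K, ‖G x‖ₑ ^ 2 := by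
          rw [← Finset.mul_sum, lintegral_biUnion_finset
            (fun K hK L hL hKL => hT.disjoint K hK L hL hKL)
            (fun K _ => isOpen_interior.measurableSet)]
      _ ≤ _ := by
          gcongr
          exact iUnion₂_subset fun K hK => hT.interior_subset_domain hD hK
  have hcoe : ∫⁻ x in D, ‖((projPC D T v : L2 D) - v : L2 D) x‖ₑ ^ 2 =
      ∫⁻ x in D, ‖(projPC D T v : L2 D) x - v x‖ₑ ^ 2 := by
    refine lintegral_congr_ae ?_
    filter_upwards [Lp.coeFn_sub (projPC D T v : L2 D) v] with x hx
    rw [hx, Pi.sub_apply]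
  rw [← hcoe, ← eLpNorm_two_sq, ← eLpNorm_two_sq, ← mul_pow] at hsq
  have hle := (ENNReal.pow_le_pow_left_iff two_ne_zero).1 hsq
  rw [← Lp.enorm_def, ← Lp.enorm_def, ← ofReal_norm, ← ofReal_norm,
    ← ENNReal.ofReal_mul (by positivity)] at hle
  exact (ENNReal.ofReal_le_ofReal_iff (by positivity)).1 hle

end Mesh

theorem IsMeshFamily.isProjectionConstant_two {d : ℕ} {D : Set (Eucl d)}
    (hD : IsConvexDomain D) (hd : d ≤ 2) {I : Set ℝ} {T : ℝ → Finset (Set (Eucl d))}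
    (hT : IsMeshFamily D I T) : IsProjectionConstant D I T 2 :=
  ⟨fun h hh _ hK _ hv => (hT.mesh h hh).eLpNorm_projPC_sub_le hD hd hK hv,
    fun h hh _ hv => (hT.mesh h hh).norm_projPC_sub_le hD hd
      (fun K hK => (hT.meshSize h hh).2 ⟨K, hK, rfl⟩) (hT.pos h hh).le hv⟩

/-! ### Functions that are finite exactly on a set -/

section ConvexAnalysis

variable {H : Type*}

/-- `φ` equals the real function `g` on `C` and `∞` off `C`. -/
def IsExtension (φ : H → EReal) (C : Set H) (g : H → ℝ) : Prop :=
  (∀ w ∈ C, φ w = (g w : EReal)) ∧ ∀ w ∉ C, φ w = ⊤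

theorem isExtension_indicatorFun (C : Set H) : IsExtension (indicatorFun C) C fun _ => 0 :=
  ⟨fun w hw => by simp [indicatorFun, hw], fun w hw => by simp [indicatorFun, hw]⟩

namespace IsExtension

variable {φ : H → EReal} {C : Set H} {g : H → ℝ}

theorem isProper (h : IsExtension φ C g) (hC : C.Nonempty) : IsProper φ := by
  obtain ⟨w, hw⟩ := hC
  refine ⟨fun u => ?_, w, by rw [h.1 w hw]; exact EReal.coe_ne_top _⟩
  by_cases hu : u ∈ C
  · rw [h.1 u hu]; exact EReal.coe_ne_bot _
  · rw [h.2 u hu]; exact top_ne_bot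

theorem effDom_eq (h : IsExtension φ C g) : effDom φ = C := by
  ext u
  by_cases hu : u ∈ C
  · simp [effDom, h.1 u hu, hu, EReal.coe_lt_top]
  · simp [effDom, h.2 u hu, hu]

/-- Convexity and closedness are defined by the epigraph, so they reduce to properties of `C` and
`g`. -/
theorem epigraph_eq (h : IsExtension φ C g) :
    {p : H × ℝ | φ p.1 ≤ (p.2 : EReal)} = {p | p.1 ∈ C ∧ g p.1 ≤ p.2} := by
  ext ⟨u, r⟩
  by_cases hu : u ∈ C
  · simp [h.1 u hu, hu]
  · simp [h.2 u hu, hu]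

theorem scaleFun (h : IsExtension φ C g) {τ : ℝ} (hτ : 0 < τ) :
    IsExtension (scaleFun φ τ) C fun w => τ⁻¹ * g w := by
  refine ⟨fun w hw => ?_, fun w hw => ?_⟩
  · rw [_root_.scaleFun, h.1 w hw, ← EReal.coe_mul]
  · rw [_root_.scaleFun, h.2 w hw, EReal.coe_mul_top_of_pos (inv_pos.2 hτ)]

variable [NormedAddCommGroup H]

/-- The variational inequality for the strongly convex objective characterizes the proximal
point. -/
theorem isProx (h : IsExtension φ C g) {u p : H} (hp : p ∈ C)
    (hmin : ∀ w ∈ C, 1 / 2 * ‖p - u‖ ^ 2 + g p + 1 / 2 * ‖w - p‖ ^ 2 ≤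
      1 / 2 * ‖w - u‖ ^ 2 + g w) : IsProx φ u p := by
  have hval : ∀ w ∈ C, (((1 / 2 : ℝ) * ‖w - u‖ ^ 2 : ℝ) : EReal) + φ w =
      ((1 / 2 * ‖w - u‖ ^ 2 + g w : ℝ) : EReal) := fun w hw => by
    rw [h.1 w hw, EReal.coe_add]
  have htop : ∀ w ∉ C, (((1 / 2 : ℝ) * ‖w - u‖ ^ 2 : ℝ) : EReal) + φ w = ⊤ := fun w hw => by
    rw [h.2 w hw, EReal.coe_add_top]
  rw [IsProx]
  ext q
  simp only [mem_ofPred_eq, mem_singleton_iff, isMinOn_univ_iff]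
  constructor
  · intro hq
    have h1 := hq p
    rw [hval p hp] at h1
    by_cases hqC : q ∈ C
    · rw [hval q hqC, EReal.coe_le_coe_iff] at h1
      have h2 := hmin q hqC
      -- The quadratic surplus in `hmin` gives uniqueness.
      have h3 : ‖q - p‖ ^ 2 ≤ 0 := by linarith
      have h4 : ‖q - p‖ = 0 := by nlinarith [norm_nonneg (q - p)]
      exact sub_eq_zero.1 (norm_eq_zero.1 h4)
    · rw [htop q hqC, top_le_iff] at h1
      exact absurd h1 (EReal.coe_ne_top _)
  · rintro rfl w
    rw [hval q hp]
    by_cases hw : w ∈ C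
    · rw [hval w hw, EReal.coe_le_coe_iff]
      nlinarith [hmin w hw, sq_nonneg ‖w - q‖]
    · rw [htop w hw]; exact le_top

theorem isClosedFun (h : IsExtension φ C g) (hC : IsClosed C) (hg : Continuous g) :
    IsClosedFun φ := by
  rw [IsClosedFun, h.epigraph_eq]
  exact (hC.preimage continuous_fst).inter
    (isClosed_le (hg.comp continuous_fst) continuous_snd)

variable [InnerProductSpace ℝ H]

theorem isConvexFun (h : IsExtension φ C g) (hg : ConvexOn ℝ C g) : IsConvexFun φ := by
  rw [IsConvexFun, h.epigraph_eq]
  exact hg.convex_epigraph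

end IsExtension

end ConvexAnalysis

/-! ### Pointwise soft thresholding with bounds -/

/-- The variational inequality for the scalar function `½(x - v)² + lam |x|` on `[l, u]`. -/
theorem clamp_softThreshold_variational {l u v lam w s p : ℝ} (hlu : l ≤ u) (hlam : 0 ≤ lam)
    (hlw : l ≤ w) (hwu : w ≤ u) (hs : s = v - min (max v (-lam)) lam)
    (hp : p = min (max s l) u) :
    1 / 2 * (p - v) ^ 2 + lam * |p| + 1 / 2 * (w - p) ^ 2 ≤ 1 / 2 * (w - v) ^ 2 + lam * |w| := by
  obtain ⟨γ, hγ⟩ : ∃ γ, γ = min (max v (-lam)) lam := ⟨_, rfl⟩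
  rw [← hγ] at hs
  have hγ1 : -lam ≤ γ := hγ ▸ le_min (le_max_right _ _) (by linarith)
  have hγ2 : γ ≤ lam := hγ ▸ min_le_right _ _
  -- `γ` is a subgradient of `lam |·|` at `s`
  have hpos : 0 < s → γ = lam := by
    intro h; rw [hγ] at hs ⊢
    rcases le_total v (-lam) with h1 | h1 <;> rcases le_total v lam with h2 | h2 <;>
      simp only [max_eq_left, max_eq_right, min_eq_left, min_eq_right, h1, h2,
        show -lam ≤ lam by linarith] at hs ⊢ <;> linarith
  have hneg : s < 0 → γ = -lam := by
    intro h; rw [hγ] at hs ⊢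
    rcases le_total v (-lam) with h1 | h1 <;> rcases le_total v lam with h2 | h2 <;>
      simp only [max_eq_left, max_eq_right, min_eq_left, min_eq_right, h1, h2,
        show -lam ≤ lam by linarith] at hs ⊢ <;> linarith
  -- The subgradient inequality at `s` persists at a base point `x` between `s` and `y`, because
  -- slopes of a convex function are monotone. It is needed at `x = p`, since clamping moves `s`
  -- towards `w`.
  have hsub : ∀ x y : ℝ, (s ≤ x ∧ x ≤ y) ∨ (y ≤ x ∧ x ≤ s) ∨ x = s →
      γ * (y - x) ≤ lam * |y| - lam * |x| := by
    intro x y hxy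
    rcases lt_trichotomy s 0 with h | h | h
    · rw [hneg h]
      rcases hxy with ⟨h1, h2⟩ | ⟨h1, h2⟩ | rfl
      · have := abs_sub_abs_le_abs_sub x y
        rw [abs_of_nonpos (by linarith : x - y ≤ 0)] at this
        nlinarith
      · rw [abs_of_neg (by linarith : x < 0), abs_of_neg (by linarith : y < 0)]; linarith
      · rw [abs_of_neg h]; nlinarith [neg_abs_le y]
    · rcases hxy with ⟨h1, h2⟩ | ⟨h1, h2⟩ | rfl
      · rw [abs_of_nonneg (by linarith : 0 ≤ x), abs_of_nonneg (by linarith : 0 ≤ y)]; nlinarith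
      · rw [abs_of_nonpos (by linarith : x ≤ 0), abs_of_nonpos (by linarith : y ≤ 0)]; nlinarith
      · rw [h, abs_zero, sub_zero, mul_zero, sub_zero]
        rcases abs_cases y with ⟨h1, h2⟩ | ⟨h1, h2⟩ <;> rw [h1] <;> nlinarith
    · rw [hpos h]
      rcases hxy with ⟨h1, h2⟩ | ⟨h1, h2⟩ | rfl
      · rw [abs_of_pos (by linarith : 0 < x), abs_of_pos (by linarith : 0 < y)]; linarith
      · have := abs_sub_abs_le_abs_sub x y
        rw [abs_of_nonneg (by linarith : 0 ≤ x - y)] at this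
        nlinarith
      · rw [abs_of_pos h]; nlinarith [le_abs_self y]
  have hcase : (p = s) ∨ (s ≤ p ∧ p ≤ w) ∨ (w ≤ p ∧ p ≤ s) := by
    rcases le_total s l with h1 | h1
    · right; left; rw [hp, max_eq_right h1, min_eq_left hlu]; exact ⟨h1, hlw⟩
    · rcases le_total s u with h2 | h2
      · left; rw [hp, max_eq_left h1, min_eq_left h2]
      · right; right; rw [hp, max_eq_left h1, min_eq_right h2]; exact ⟨hwu, h2⟩
  have hg : γ * (w - p) ≤ lam * |w| - lam * |p| := hsub p w (by tauto)
  have hprod : 0 ≤ (w - p) * (p - s) := by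
    rcases hcase with h | ⟨h1, h2⟩ | ⟨h1, h2⟩
    · rw [h]; simp
    · exact mul_nonneg (by linarith) (by linarith)
    · exact mul_nonneg_of_nonpos_of_nonpos (by linarith) (by linarith)
  -- The right side minus the left is `(w - p) * (p - v) + lam * |w| - lam * |p|`; with `p - v = (p
  -- - s) - γ` it is nonnegative by `hprod` and `hg`.
  have hv : v = s + γ := by linarith
  rw [hv]
  nlinarith

/-! ### The lattice `L²(D)` -/

section Lattice

variable {d : ℕ} {D : Set (Eucl d)} {T : Finset (Set (Eucl d))}

theorem sup_mem_pcSpace {u v : L2 D} (hu : u ∈ pcSpace D T) (hv : v ∈ pcSpace D T) :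
    u ⊔ v ∈ pcSpace D T := by
  intro K hK
  obtain ⟨a, ha⟩ := hu K hK
  obtain ⟨b, hb⟩ := hv K hK
  refine ⟨a ⊔ b, ?_⟩
  filter_upwards [Lp.coeFn_sup u v, ha, hb] with x hx h1 h2 hxK
  rw [hx, Pi.sup_apply, h1 hxK, h2 hxK]

theorem inf_mem_pcSpace {u v : L2 D} (hu : u ∈ pcSpace D T) (hv : v ∈ pcSpace D T) :
    u ⊓ v ∈ pcSpace D T := by
  intro K hK
  obtain ⟨a, ha⟩ := hu K hK
  obtain ⟨b, hb⟩ := hv K hK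
  refine ⟨a ⊓ b, ?_⟩
  filter_upwards [Lp.coeFn_inf u v, ha, hb] with x hx h1 h2 hxK
  rw [hx, Pi.inf_apply, h1 hxK, h2 hxK]

theorem mem_pcSpace_of_ae_eq_const {v : L2 D} {a : ℝ} (h : ∀ᵐ x ∂(volume.restrict D), v x = a) :
    v ∈ pcSpace D T := fun _ _ => ⟨a, h.mono fun _ hx _ => hx⟩

theorem L2.inner_nonneg_of_nonneg {u v : L2 D} (hu : 0 ≤ u) (hv : 0 ≤ v) :
    0 ≤ inner ℝ u v := by
  rw [MeasureTheory.L2.inner_def]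
  refine integral_nonneg_of_ae ?_
  filter_upwards [(Lp.coeFn_nonneg u).2 hu, (Lp.coeFn_nonneg v).2 hv] with x h1 h2
  simpa using mul_nonneg h2 h1

theorem L2.inner_sup_zero_sup_neg_zero (w : L2 D) : inner ℝ (w ⊔ 0) (-w ⊔ 0) = 0 := by
  rw [MeasureTheory.L2.inner_def]
  refine integral_eq_zero_of_ae ?_
  filter_upwards [Lp.coeFn_sup w 0, Lp.coeFn_sup (-w) 0, Lp.coeFn_neg w,
    Lp.coeFn_zero ℝ 2 (volume.restrict D)] with x h1 h2 h3 h4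
  rw [h1, h2, Pi.sup_apply, Pi.sup_apply, h3, h4, Pi.neg_apply, Pi.zero_apply]
  rcases le_total (w x) 0 with h | h <;> simp [h]

/-- The negative part of the projection `w` is again piecewise constant. Its inner product with `w`
is minus its squared norm, but equals its inner product with `v ≥ 0`; hence it vanishes. -/
theorem projPC_nonneg {v : L2 D} (hv : 0 ≤ v) : 0 ≤ (projPC D T v : L2 D) := by
  set w : L2 D := (projPC D T v : L2 D) with hw
  have hn : -w ⊔ 0 ∈ pcSpace D T :=
    sup_mem_pcSpace ((pcSpace D T).neg_mem (projPC D T v).2) (pcSpace D T).zero_mem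
  have h1 : inner ℝ (-w ⊔ 0) w = inner ℝ (-w ⊔ 0) v := inner_projPC_eq hn v
  have h2 : 0 ≤ inner ℝ (-w ⊔ 0) v := L2.inner_nonneg_of_nonneg le_sup_right hv
  have h3 : w + (-w ⊔ 0) = w ⊔ 0 := by rw [add_sup]; simp [sup_comm]
  have h4 := L2.inner_sup_zero_sup_neg_zero w
  rw [← h3, inner_add_left, real_inner_comm, h1] at h4
  have h5 : inner ℝ (-w ⊔ 0) (-w ⊔ 0) ≤ (0 : ℝ) := by linarith
  have h6 : -w ⊔ 0 = 0 := inner_self_eq_zero.1 (le_antisymm h5 real_inner_self_nonneg)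
  exact neg_nonpos.1 (sup_eq_right.1 h6)

theorem projPC_mono {u v : L2 D} (h : u ≤ v) : (projPC D T u : L2 D) ≤ (projPC D T v : L2 D) := by
  have := projPC_nonneg (T := T) (sub_nonneg.2 h)
  rw [map_sub, Submodule.coe_sub] at this
  exact sub_nonneg.1 this

theorem projPC_mem_discreteBox {lo up v : L2 D} (hv : v ∈ Icc lo up) :
    projPC D T v ∈ discreteBox D T (projPC D T lo) (projPC D T up) :=
  ⟨projPC_mono hv.1, projPC_mono hv.2⟩

theorem integral_abs_add_le (u v : L2 D) [IsFiniteMeasure (volume.restrict D)] :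
    ∫ x in D, |(u + v : L2 D) x| ≤ (∫ x in D, |u x|) + ∫ x in D, |v x| := by
  have hi : ∀ w : L2 D, Integrable (fun x => |w x|) (volume.restrict D) := fun w =>
    ((Lp.memLp w).integrable one_le_two).abs
  rw [← integral_add (hi u) (hi v)]
  refine integral_mono_ae (hi _) ((hi u).add (hi v)) ?_
  filter_upwards [Lp.coeFn_add u v] with x hx
  rw [hx]
  exact abs_add_le _ _

theorem integral_abs_smul (c : ℝ) (v : L2 D) :
    ∫ x in D, |(c • v : L2 D) x| = |c| * ∫ x in D, |v x| := by
  rw [← integral_const_mul]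
  refine integral_congr_ae ?_
  filter_upwards [Lp.coeFn_smul c v] with x hx
  rw [hx, Pi.smul_apply, smul_eq_mul, abs_mul]

theorem convexOn_integral_abs [IsFiniteMeasure (volume.restrict D)] :
    ConvexOn ℝ univ fun v : L2 D => ∫ x in D, |v x| := by
  refine ⟨convex_univ, fun u _ v _ a b ha hb _ => ?_⟩
  refine (integral_abs_add_le _ _).trans (le_of_eq ?_)
  simp only [integral_abs_smul, abs_of_nonneg ha, abs_of_nonneg hb, smul_eq_mul]

/-- On a set of finite measure this is the inner product of `|v|` with the constant 1, and the
lattice operations of `L²` are continuous. -/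
theorem continuous_integral_abs [IsFiniteMeasure (volume.restrict D)] :
    Continuous fun v : L2 D => ∫ x in D, |v x| := by
  have h : ∀ v : L2 D, ∫ x in D, |v x| =
      inner ℝ (indicatorConstLp 2 MeasurableSet.univ (measure_ne_top _ _) (1 : ℝ) : L2 D)
        (v ⊔ -v) := by
    intro v
    rw [MeasureTheory.L2.inner_indicatorConstLp_one, Measure.restrict_univ]
    refine integral_congr_ae ?_
    filter_upwards [Lp.coeFn_abs v] with x hx
    exact hx.symm
  simp_rw [h]
  exact continuous_const.inner (continuous_id.sup continuous_neg)

theorem l1Norm_eq [IsFiniteMeasure (volume.restrict D)] (v : L2 D) :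
    l1Norm D v = ENNReal.ofReal (∫ x in D, |v x|) := by
  rw [l1Norm, eLpNorm_one_eq_lintegral_enorm,
    ofReal_integral_eq_lintegral_ofReal ((Lp.memLp v).integrable one_le_two).abs
      (ae_of_all _ fun _ => abs_nonneg _)]
  simp_rw [Real.enorm_eq_ofReal_abs]

theorem integral_projPC [IsFiniteMeasure (volume.restrict D)] (v : L2 D) :
    ∫ x in D, (projPC D T v : L2 D) x = ∫ x in D, v x := by
  have h1 : (indicatorConstLp 2 MeasurableSet.univ (measure_ne_top _ _) (1 : ℝ) : L2 D) ∈
      pcSpace D T := by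
    refine mem_pcSpace_of_ae_eq_const (a := 1) ?_
    filter_upwards [indicatorConstLp_coeFn (p := 2) (hs := MeasurableSet.univ)
      (hμs := measure_ne_top (volume.restrict D) univ) (c := (1 : ℝ))] with x hx
    rw [hx, indicator_of_mem (mem_univ x)]
  have h := inner_projPC_eq h1 v
  rwa [MeasureTheory.L2.inner_indicatorConstLp_one, MeasureTheory.L2.inner_indicatorConstLp_one,
    Measure.restrict_univ] at h

/-- Order preservation gives `|Π_h v| ≤ Π_h |v|`, and the projection preserves integrals because the
constant 1 is piecewise constant. -/
theorem l1Norm_projPC_le [IsFiniteMeasure (volume.restrict D)] (v : L2 D) :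
    l1Norm D (projPC D T v : L2 D) ≤ l1Norm D v := by
  rw [l1Norm_eq, l1Norm_eq]
  refine ENNReal.ofReal_le_ofReal ?_
  have hle : |(projPC D T v : L2 D)| ≤ (projPC D T |v| : L2 D) := by
    refine abs_le'.2 ⟨projPC_mono (le_abs_self v), ?_⟩
    have := projPC_mono (T := T) (neg_le_abs v)
    rwa [map_neg, Submodule.coe_neg] at this
  have hi : ∀ w : L2 D, Integrable w (volume.restrict D) := fun w =>
    (Lp.memLp w).integrable one_le_two
  calc ∫ x in D, |(projPC D T v : L2 D) x| ≤ ∫ x in D, (projPC D T |v| : L2 D) x := by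
        refine integral_mono_ae (hi _).abs (hi _) ?_
        filter_upwards [Lp.coeFn_abs (projPC D T v : L2 D), (Lp.coeFn_le _ _).2 hle] with x h1 h2
        rwa [h1] at h2
    _ = ∫ x in D, |v| x := integral_projPC _
    _ = ∫ x in D, |v x| := integral_congr_ae (Lp.coeFn_abs v)

/-- Soft thresholding of `v` at level `lam`, followed by the projection onto `[lo, up]`. -/
noncomputable def clampSoft [IsFiniteMeasure (volume.restrict D)] (lam : ℝ) (lo up v : L2 D) :
    L2 D :=
  ((v - (v ⊔ -Lp.const 2 (volume.restrict D) lam) ⊓ Lp.const 2 (volume.restrict D) lam) ⊔ lo) ⊓ up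

theorem clampSoft_mem_Icc [IsFiniteMeasure (volume.restrict D)] (lam : ℝ) {lo up : L2 D}
    (h : lo ≤ up) (v : L2 D) : clampSoft lam lo up v ∈ Icc lo up :=
  ⟨le_inf le_sup_right h, inf_le_right⟩

theorem clampSoft_mem_pcSpace [IsFiniteMeasure (volume.restrict D)] (lam : ℝ) {lo up v : L2 D}
    (hlo : lo ∈ pcSpace D T) (hup : up ∈ pcSpace D T) (hv : v ∈ pcSpace D T) :
    clampSoft lam lo up v ∈ pcSpace D T := by
  have hc : Lp.const 2 (volume.restrict D) lam ∈ pcSpace D T :=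
    mem_pcSpace_of_ae_eq_const (a := lam) (Lp.coeFn_const 2 (volume.restrict D) lam)
  exact inf_mem_pcSpace (sup_mem_pcSpace ((pcSpace D T).sub_mem hv
    (inf_mem_pcSpace (sup_mem_pcSpace hv ((pcSpace D T).neg_mem hc)) hc)) hlo) hup

/-- The thresholded function is the same in both terms, and suprema and infima are 1-Lipschitz in
each argument in a normed lattice. -/
theorem norm_clampSoft_sub_le [IsFiniteMeasure (volume.restrict D)] (lam : ℝ)
    (lo up lo' up' v : L2 D) :
    ‖clampSoft lam lo up v - clampSoft lam lo' up' v‖ ≤ ‖lo - lo'‖ + ‖up - up'‖ := by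
  refine (norm_inf_sub_inf_le_add_norm _ _ _ _).trans ?_
  gcongr
  refine (norm_sup_sub_sup_le_add_norm _ _ _ _).trans ?_
  simp

theorem L2.norm_sq_eq (v : L2 D) : ‖v‖ ^ 2 = ∫ x in D, v x ^ 2 := by
  rw [← real_inner_self_eq_norm_sq, MeasureTheory.L2.inner_def]
  exact integral_congr_ae (ae_of_all _ fun x => by simp [pow_two])

/-- Objective and constraint are both pointwise, so the scalar inequality can be integrated. -/
theorem clampSoft_variational [IsFiniteMeasure (volume.restrict D)] {lam : ℝ} (hlam : 0 ≤ lam)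
    {lo up : L2 D} (hlu : lo ≤ up) (v : L2 D) {w : L2 D} (hw : w ∈ Icc lo up) :
    1 / 2 * ‖clampSoft lam lo up v - v‖ ^ 2 + lam * (∫ x in D, |clampSoft lam lo up v x|) +
        1 / 2 * ‖w - clampSoft lam lo up v‖ ^ 2 ≤
      1 / 2 * ‖w - v‖ ^ 2 + lam * ∫ x in D, |w x| := by
  set p := clampSoft lam lo up v with hp
  have hsq : ∀ f : L2 D, Integrable (fun x => 1 / 2 * f x ^ 2) (volume.restrict D) := fun f =>
    (Lp.memLp f).integrable_sq.const_mul _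
  have habs : ∀ f : L2 D, Integrable (fun x => lam * |f x|) (volume.restrict D) := fun f =>
    ((Lp.memLp f).integrable one_le_two).abs.const_mul _
  have hadd : ∀ f g : L2 D, Integrable (fun x => 1 / 2 * f x ^ 2 + lam * |g x|)
      (volume.restrict D) := fun f g => (hsq f).add (habs g)
  rw [L2.norm_sq_eq, L2.norm_sq_eq, L2.norm_sq_eq, ← integral_const_mul, ← integral_const_mul,
    ← integral_const_mul, ← integral_const_mul, ← integral_const_mul,
    ← integral_add (hsq _) (habs _), ← integral_add (hadd _ _) (hsq _),
    ← integral_add (hsq _) (habs _)]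
  refine integral_mono_ae ((hadd _ _).add (hsq _)) (hadd _ _) ?_
  set c := Lp.const 2 (volume.restrict D) lam with hc
  filter_upwards [Lp.coeFn_sub p v, Lp.coeFn_sub w p, Lp.coeFn_sub w v,
    Lp.coeFn_inf ((v - (v ⊔ -c) ⊓ c) ⊔ lo) up, Lp.coeFn_sup (v - (v ⊔ -c) ⊓ c) lo,
    Lp.coeFn_sub v ((v ⊔ -c) ⊓ c), Lp.coeFn_inf (v ⊔ -c) c, Lp.coeFn_sup v (-c),
    Lp.coeFn_neg c, Lp.coeFn_const 2 (volume.restrict D) lam,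
    (Lp.coeFn_le _ _).2 hlu, (Lp.coeFn_le _ _).2 hw.1, (Lp.coeFn_le _ _).2 hw.2]
    with x h1 h2 h3 h4 h5 h6 h7 h8 h9 h10 h11 h12 h13
  rw [h1, h2, h3]
  refine clamp_softThreshold_variational (l := lo x) (u := up x) h11 hlam h12 h13 rfl ?_
  have h4' : p x = min (((v - (v ⊔ -c) ⊓ c) ⊔ lo : L2 D) x) (up x) := h4
  rw [h4', h5, Pi.sup_apply, h6, Pi.sub_apply, h7, Pi.inf_apply, h8, Pi.sup_apply, h9,
    Pi.neg_apply, h10]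
  rfl

end Lattice

/-! ### The regularizers -/

section Regularizer

variable {d : ℕ} {D : Set (Eucl d)} {T : Finset (Set (Eucl d))}

theorem coe_ofReal_mul_l1Norm [IsFiniteMeasure (volume.restrict D)] {β : ℝ} (hβ : 0 ≤ β)
    (w : L2 D) : ((ENNReal.ofReal β * l1Norm D w : ℝ≥0∞) : EReal) =
      ((β * ∫ x in D, |w x| : ℝ) : EReal) := by
  have h0 : 0 ≤ ∫ x in D, |w x| := integral_nonneg fun _ => abs_nonneg _
  rw [l1Norm_eq, ← ENNReal.ofReal_mul hβ, EReal.coe_ennreal_ofReal,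
    max_eq_left (mul_nonneg hβ h0)]

theorem isExtension_psi [IsFiniteMeasure (volume.restrict D)] {β : ℝ} (hβ : 0 ≤ β)
    (lo up : L2 D) :
    IsExtension (psi D β lo up) (Icc lo up) fun w => β * ∫ x in D, |w x| := by
  refine ⟨fun w hw => ?_, fun w hw => ?_⟩
  · rw [psi, coe_ofReal_mul_l1Norm hβ, (isExtension_indicatorFun _).1 w hw, EReal.coe_zero,
      add_zero]
  · rw [psi, coe_ofReal_mul_l1Norm hβ, (isExtension_indicatorFun _).2 w hw, EReal.coe_add_top]

theorem isExtension_psiH [IsFiniteMeasure (volume.restrict D)] {β : ℝ} (hβ : 0 ≤ β)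
    (lo up : pcSpace D T) :
    IsExtension (psiH D T β lo up) (discreteBox D T lo up)
      fun w => β * ∫ x in D, |(w : L2 D) x| := by
  refine ⟨fun w hw => ?_, fun w hw => ?_⟩
  · rw [psiH, coe_ofReal_mul_l1Norm hβ, (isExtension_indicatorFun _).1 w hw, EReal.coe_zero,
      add_zero]
  · rw [psiH, coe_ofReal_mul_l1Norm hβ, (isExtension_indicatorFun _).2 w hw, EReal.coe_add_top]

theorem convex_Icc_L2 (lo up : L2 D) : Convex ℝ (Icc lo up) := by
  intro u hu v hv a b ha hb hab
  have hlo : lo = a • lo + b • lo := by rw [← add_smul, hab, one_smul]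
  have hup : up = a • up + b • up := by rw [← add_smul, hab, one_smul]
  have key : ∀ u v u' v' : L2 D, u ≤ u' → v ≤ v' → a • u + b • v ≤ a • u' + b • v' := by
    intro u v u' v' h1 h2
    rw [← Lp.coeFn_le]
    filter_upwards [(Lp.coeFn_le _ _).2 h1, (Lp.coeFn_le _ _).2 h2,
      Lp.coeFn_add (a • u) (b • v), Lp.coeFn_add (a • u') (b • v'), Lp.coeFn_smul a u,
      Lp.coeFn_smul b v, Lp.coeFn_smul a u', Lp.coeFn_smul b v'] with x e1 e2 e3 e4 e5 e6 e7 e8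
    rw [e3, e4, Pi.add_apply, Pi.add_apply, e5, e6, e7, e8]
    simp only [Pi.smul_apply, smul_eq_mul]
    gcongr
  constructor
  · rw [hlo]; exact key _ _ _ _ hu.1 hv.1
  · rw [hup]; exact key _ _ _ _ hu.2 hv.2

theorem convex_discreteBox (lo up : pcSpace D T) : Convex ℝ (discreteBox D T lo up) :=
  (convex_Icc_L2 (lo : L2 D) (up : L2 D)).linear_preimage (pcSpace D T).subtype

theorem isClosed_discreteBox (lo up : pcSpace D T) : IsClosed (discreteBox D T lo up) :=
  isClosed_Icc.preimage continuous_subtype_val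

theorem psi_regular [IsFiniteMeasure (volume.restrict D)] {β : ℝ} (hβ : 0 ≤ β)
    {lo up : L2 D} (h : lo ≤ up) :
    IsProper (psi D β lo up) ∧ IsConvexFun (psi D β lo up) ∧ IsClosedFun (psi D β lo up) ∧
      effDom (psi D β lo up) = Icc lo up := by
  have he := isExtension_psi hβ lo up
  refine ⟨he.isProper ⟨lo, le_rfl, h⟩, he.isConvexFun ?_,
    he.isClosedFun isClosed_Icc (continuous_integral_abs.const_mul β), he.effDom_eq⟩
  exact (convexOn_integral_abs.smul hβ).subset (subset_univ _) (convex_Icc_L2 lo up)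

theorem psiH_regular [IsFiniteMeasure (volume.restrict D)] {β : ℝ} (hβ : 0 ≤ β)
    {lo up : pcSpace D T} (h : (lo : L2 D) ≤ up) :
    IsProper (psiH D T β lo up) ∧ IsConvexFun (psiH D T β lo up) ∧
      IsClosedFun (psiH D T β lo up) ∧ effDom (psiH D T β lo up) = discreteBox D T lo up := by
  have he := isExtension_psiH hβ lo up
  refine ⟨he.isProper ⟨lo, le_rfl, h⟩, he.isConvexFun ?_,
    he.isClosedFun (isClosed_discreteBox lo up)
      ((continuous_integral_abs.comp continuous_subtype_val).const_mul β), he.effDom_eq⟩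
  exact ((convexOn_integral_abs.smul hβ).comp_linearMap (pcSpace D T).subtype).subset
    (subset_univ _) (convex_discreteBox lo up)

/-- Functions of the form `lam ‖·‖_{L¹}` on a box have the clamped soft thresholding as their
proximity operators, both in `L²(D)` and in the space of piecewise constant functions. -/
theorem exists_isProx_norm_sub_le [IsFiniteMeasure (volume.restrict D)] {lam : ℝ}
    (hlam : 0 ≤ lam) {lo up : L2 D} (h : lo ≤ up) {φ : L2 D → EReal} {φh : pcSpace D T → EReal}
    (hφ : IsExtension φ (Icc lo up) fun w => lam * ∫ x in D, |w x|)
    (hφh : IsExtension φh (discreteBox D T (projPC D T lo) (projPC D T up))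
      fun w => lam * ∫ x in D, |(w : L2 D) x|) (v : pcSpace D T) :
    ∃ (p : L2 D) (q : pcSpace D T), IsProx φ (v : L2 D) p ∧ IsProx φh v q ∧
      ‖p - (q : L2 D)‖ ≤ ‖(projPC D T lo : L2 D) - lo‖ + ‖(projPC D T up : L2 D) - up‖ := by
  have hh : (projPC D T lo : L2 D) ≤ projPC D T up := projPC_mono h
  refine ⟨clampSoft lam lo up v, ⟨clampSoft lam (projPC D T lo : L2 D) (projPC D T up) v,
    clampSoft_mem_pcSpace lam (projPC D T lo).2 (projPC D T up).2 v.2⟩,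
    hφ.isProx (clampSoft_mem_Icc lam h v) fun w hw => clampSoft_variational hlam h v hw,
    hφh.isProx (clampSoft_mem_Icc lam hh v) fun w hw => clampSoft_variational hlam hh v hw, ?_⟩
  rw [norm_sub_rev _ lo, norm_sub_rev _ up]
  exact norm_clampSoft_sub_le lam _ _ _ _ _

end Regularizer

/-! ### Assembly of the theorem -/

theorem mainTheorem5 :
    ∃ c₀ : ℝ, 0 < c₀ ∧
    ∀ (d : ℕ), d = 1 ∨ d = 2 →
    ∀ (D : Set (Eucl d)), IsConvexDomain D →
    ∀ (I : Set ℝ) (T : ℝ → Finset (Set (Eucl d))), IsMeshFamily D I T →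
    -- `c₀` is an admissible constant `c_Π`
    IsProjectionConstant D I T c₀ ∧
    ∀ (β : ℝ), 0 ≤ β →
    ∀ (lo up : L2 D),
      MemH1 D lo → MemLp lo ∞ (volume.restrict D) →
      MemH1 D up → MemLp up ∞ (volume.restrict D) → lo ≤ up →
    -- (a) the estimates hold with every admissible constant `c_Π`
    (∀ c : ℝ, 0 < c → IsProjectionConstant D I T c →
      ∀ h ∈ I, ∀ τ : ℝ, 0 < τ → ∀ v : pcSpace D (T h),
        (∃ (p : L2 D) (q : pcSpace D (T h)),
          IsProj (Icc lo up) (v : L2 D) p ∧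
          IsProj (discreteBox D (T h) (projPC D (T h) lo) (projPC D (T h) up)) v q ∧
          ‖p - (q : L2 D)‖ ≤ c * h * (h1Seminorm D lo + h1Seminorm D up)) ∧
        (∃ (p : L2 D) (q : pcSpace D (T h)),
          IsProx (scaleFun (psi D β lo up) τ) (v : L2 D) p ∧
          IsProx (scaleFun
            (psiH D (T h) β (projPC D (T h) lo) (projPC D (T h) up)) τ) v q ∧
          ‖p - (q : L2 D)‖ ≤ c * h * (h1Seminorm D lo + h1Seminorm D up))) ∧
    -- (b)
    (IsProper (psi D β lo up) ∧ IsConvexFun (psi D β lo up) ∧ IsClosedFun (psi D β lo up) ∧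
      effDom (psi D β lo up) = Icc lo up) ∧
    -- (c)
    (∀ h ∈ I, ∀ v ∈ Icc lo up,
      projPC D (T h) v ∈ discreteBox D (T h) (projPC D (T h) lo) (projPC D (T h) up)) ∧
    -- (d)
    (∀ h ∈ I,
      IsProper (psiH D (T h) β (projPC D (T h) lo) (projPC D (T h) up)) ∧
      IsConvexFun (psiH D (T h) β (projPC D (T h) lo) (projPC D (T h) up)) ∧
      IsClosedFun (psiH D (T h) β (projPC D (T h) lo) (projPC D (T h) up)) ∧
      effDom (psiH D (T h) β (projPC D (T h) lo) (projPC D (T h) up)) =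
        discreteBox D (T h) (projPC D (T h) lo) (projPC D (T h) up)) ∧
    -- (e) constant bounds
    ((∃ a : ℝ, ∀ᵐ x ∂(volume.restrict D), lo x = a) →
      (∃ b : ℝ, ∀ᵐ x ∂(volume.restrict D), up x = b) →
      ∀ h ∈ I,
        (∀ w ∈ effDom (psiH D (T h) β (projPC D (T h) lo) (projPC D (T h) up)),
          (w : L2 D) ∈ effDom (psi D β lo up)) ∧
        (∀ w : pcSpace D (T h),
          psiH D (T h) β (projPC D (T h) lo) (projPC D (T h) up) w = psi D β lo up w)) ∧
    -- (f)
    (∀ h ∈ I, ∀ w : L2 D, l1Norm D (projPC D (T h) w : L2 D) ≤ l1Norm D w) := by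
  refine ⟨2, two_pos, fun d hd D hD I T hT => ⟨hT.isProjectionConstant_two hD (by omega), ?_⟩⟩
  intro β hβ lo up hlo _ hup _ hle
  have := hD.isFiniteMeasure
  refine ⟨fun c _ hc h hh τ hτ v => ?_, psi_regular hβ hle,
    fun h _ v hv => projPC_mem_discreteBox hv, fun h _ => psiH_regular hβ (projPC_mono hle), ?_,
    fun h _ w => l1Norm_projPC_le w⟩
  · have hbound : ‖(projPC D (T h) lo : L2 D) - lo‖ + ‖(projPC D (T h) up : L2 D) - up‖ ≤
        c * h * (h1Seminorm D lo + h1Seminorm D up) := by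
      rw [mul_add]
      exact add_le_add (hc.2 h hh lo hlo) (hc.2 h hh up hup)
    constructor
    -- The projections are the case `lam = 0`, where no thresholding takes place.
    · have h1 := isExtension_indicatorFun (Icc lo up)
      have h2 := isExtension_indicatorFun
        (discreteBox D (T h) (projPC D (T h) lo) (projPC D (T h) up))
      obtain ⟨p, q, hp, hq, hpq⟩ := exists_isProx_norm_sub_le le_rfl hle
        (by simpa only [zero_mul] using h1) (by simpa only [zero_mul] using h2) v
      exact ⟨p, q, hp, hq, hpq.trans hbound⟩
    -- Dividing by `τ` changes only the threshold, to `τ⁻¹ * β`; the box stays the same.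
    · have h1 := (isExtension_psi hβ lo up).scaleFun hτ
      have h2 := (isExtension_psiH hβ (projPC D (T h) lo) (projPC D (T h) up)).scaleFun hτ
      simp only [← mul_assoc] at h1 h2
      obtain ⟨p, q, hp, hq, hpq⟩ :=
        exists_isProx_norm_sub_le (mul_nonneg (inv_nonneg.2 hτ.le) hβ) hle h1 h2 v
      exact ⟨p, q, hp, hq, hpq.trans hbound⟩
  · rintro ⟨a, ha⟩ ⟨b, hb⟩ h _
    -- Constants are piecewise constant, so the projection fixes the bounds and the two boxes agree
    -- on the discrete space.
    have e1 : (projPC D (T h) lo : L2 D) = lo := projPC_eq_self (mem_pcSpace_of_ae_eq_const ha)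
    have e2 : (projPC D (T h) up : L2 D) = up := projPC_eq_self (mem_pcSpace_of_ae_eq_const hb)
    have key : ∀ w : pcSpace D (T h),
        psiH D (T h) β (projPC D (T h) lo) (projPC D (T h) up) w = psi D β lo up w := by
      intro w
      have hw : w ∈ discreteBox D (T h) (projPC D (T h) lo) (projPC D (T h) up) ↔
          (w : L2 D) ∈ Icc lo up := by rw [discreteBox, mem_ofPred_eq, e1, e2]
      rw [psiH, psi, indicatorFun, indicatorFun]
      by_cases hwI : (w : L2 D) ∈ Icc lo up
      · rw [if_pos (hw.2 hwI), if_pos hwI]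
      · rw [if_neg (mt hw.1 hwI), if_neg hwI]
    refine ⟨fun w hw => ?_, key⟩
    rw [effDom, mem_ofPred_eq] at hw ⊢
    rwa [← key w]
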